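/- Let $\mathsf{ZMC}_\omega$ be the first-order theory in the language $\{\in\}$ with the following axioms: Extensionality, Pairing, Union, Infinity, Regularity and the full Separation schema (that is, Zermelo set theory with Regularity but without the Power Set axiom and without Choice), together with - *Finite-closed superset*: every set $X$ has a superset $Y\supseteq X$ such that every finite $x\subseteq Y$ satisfies $x\in Y$; - *Transitive superset*: every set $X$ has a transitive superset $Y\supseteq X$; - *Mostowski Collapse*: for every set $A$ of ordered pairs that is well-founded (every nonempty set $S\subseteq|A|=\operatorname{dom}A\cup\operatorname{ran}A$ has an $A$-minimal element) and extensional (elements of $|A|$ with the same $A$-predecessors are equal) there are a transitive set $X$ and a bijection $\xi$ of $|A|$ onto $X$ such that $\langle j,k\rangle\in A\iff\xi(j)\in\xi(k)$ for all $j,k\in|A|$; - *Countability*: every set admits an injection into $\omega$. For a set $X$, let $\operatorname{Def}X$ be the collection of all sets $\{x\in X: X\models\varphi(x)\}$, where $\varphi(v)$ is a (coded) $\in$-formula with parameters in $X$, and $X\models\cdot$ is defined inside the theory by means of Tarski truth sets. Let $L_0=\varnothing$, $L_{\alpha+1}=\operatorname{Def}L_\alpha$, $L_\lambda=\bigcup_{\alpha<\lambda}L_\alpha$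 for limit $\lambda$, and $L=\bigcup_{\alpha\in\mathrm{Ord}}L_\alpha$. (``$L_\alpha$ exists'' means that there is a set which is the last term of a sequence $\langle L_\beta:\beta\le\alpha\rangle$ that is a set and obeys this recursion.) **Theorem.** The following holds in $\mathsf{ZMC}_\omega$, that is, in every model of $\mathsf{ZMC}_\omega$ (with all notions, including ordinals, natural numbers and formulas, understood in the sense of the model): 1. each $L_\alpha$ is transitive (if it exists); 2. if $\alpha<\beta$ then $L_\alpha\in L_\beta$ and $L_\alpha\subseteq L_\beta$ (provided $L_\alpha$, $L_\beta$ exist); 3. $\alpha\subseteq L_\alpha$ (if $L_\alpha$ exists); 4. if $L_\alpha$ and $L_{\alpha+1}$ exist and $Y\in L_{\alpha+1}$, then $Y=\{y\in L_\alpha: L_\alpha\models\varphi(y)\}$ for some formula $\varphi(v)$ whose only parameters are sets of the form $L_\gamma$ with $\gamma<\alpha$; 5. for every ordinal $\alpha$, $L_\alpha$ exists as a set and is unique; hence every ordinal is an element of $L$, i.e. $\mathrm{Ord}\subseteq L$. -/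

import Mathlib

/-- The only nonlogical symbol of the language of set theory: a binary relation symbol. -/
inductive MemSymbol : ℕ → Type
  | mem : MemSymbol 2

/-- The first-order language `{∈}` of set theory. -/
def setLang : FirstOrder.Language.{0, 0} := ⟨fun _ => Empty, MemSymbol⟩

/-
All notions below are spelled out in an arbitrary `{∈}`-structure `M`, and every quantifier
(apart from the meta-quantifiers in the Separation schema) ranges over elements of `M`.  So each
of them is the interpretation in `M` of a first-order formula of the language `{∈}`.  Natural
numbers, formulas, functions, ordinals, truth sets etc. are those in the sense of `M`.
-/
namespace PowerlessSet

variable {M : Type*} [setLang.Structure M]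

/-- The membership relation of the structure `M`. -/
def In (x y : M) : Prop :=
  FirstOrder.Language.Structure.RelMap (L := setLang) (MemSymbol.mem : setLang.Relations 2) ![x, y]

infix:50 " ∊ " => In

/-! ### Elementary notions -/

/-- `x ⊆ y`. -/
def Sub (x y : M) : Prop := ∀ z, z ∊ x → z ∊ y

/-- `x = ∅`. -/
def IsEmptySet (x : M) : Prop := ∀ z, ¬ z ∊ x

/-- `z = {x, y}`. -/
def IsUPair (z x y : M) : Prop := ∀ w, w ∊ z ↔ w = x ∨ w = y

/-- `z = ⟨x, y⟩`, the Kuratowski ordered pair. -/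
def IsPair (z x y : M) : Prop := ∃ a b, IsUPair a x x ∧ IsUPair b x y ∧ IsUPair z a b

/-- `t = ⟨x, ⟨y, z⟩⟩`. -/
def IsTriple (t x y z : M) : Prop := ∃ u, IsPair u y z ∧ IsPair t x u

/-- `y = x ∪ {x}`. -/
def IsSucc (y x : M) : Prop := ∀ w, w ∊ y ↔ w ∊ x ∨ w = x

/-- `x` is a transitive set. -/
def IsTransitive (x : M) : Prop := ∀ y, y ∊ x → ∀ z, z ∊ y → z ∊ x

/-- `∅ ∈ I`, and `x ∪ {x} ∈ I` for all `x ∈ I`. -/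
def IsInductive (I : M) : Prop :=
  (∃ z, IsEmptySet z ∧ z ∊ I) ∧ ∀ x, x ∊ I → ∃ y, IsSucc y x ∧ y ∊ I

/-- `n ∈ ω`: `n` belongs to every inductive set. -/
def IsNat (n : M) : Prop := ∀ I, IsInductive I → n ∊ I

/-- `x` is the von Neumann numeral of the (metamathematical) number `k`. -/
def IsNumeral : ℕ → M → Prop
  | 0, x => IsEmptySet x
  | k + 1, x => ∃ y, IsNumeral k y ∧ IsSucc x y

/-- `⟨x, y⟩ ∈ f`. -/
def PairIn (f x y : M) : Prop := ∃ p, IsPair p x y ∧ p ∊ f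

/-- `f` is a set of ordered pairs. -/
def IsRel (f : M) : Prop := ∀ p, p ∊ f → ∃ x y, IsPair p x y

/-- `f` is a function with domain `a`. -/
def IsFun (f a : M) : Prop :=
  IsRel f ∧ (∀ x, x ∊ a ↔ ∃ y, PairIn f x y) ∧
    ∀ x y z, PairIn f x y → PairIn f x z → y = z

/-- `f` takes each value at most once. -/
def IsInj (f : M) : Prop := ∀ x y z, PairIn f x z → PairIn f y z → x = y

/-- `f` is a bijection of `a` onto `b`. -/
def IsBij (f a b : M) : Prop :=
  IsFun f a ∧ IsInj f ∧ ∀ y, y ∊ b ↔ ∃ x, PairIn f x y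

/-- `x` is finite: in bijection with a natural number. -/
def IsFin (x : M) : Prop := ∃ n f, IsNat n ∧ IsBij f n x

/-- `Y` is finite-closed: every finite `x ⊆ Y` is an element of `Y`. -/
def IsFinClosed (Y : M) : Prop := ∀ x, Sub x Y → IsFin x → x ∊ Y

/-! ### Digraphs (sets of ordered pairs; `j A k` means `⟨j, k⟩ ∈ A`) -/

/-- `x` belongs to the field `dom A ∪ ran A` of `A`. -/
def InField (A x : M) : Prop := ∃ y, PairIn A x y ∨ PairIn A y x

/-- Every nonempty set `S ⊆ field A` has an `A`-minimal element. -/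
def IsWellFounded (A : M) : Prop :=
  ∀ S, (∃ x, x ∊ S) → (∀ x, x ∊ S → InField A x) →
    ∃ k, k ∊ S ∧ ∀ j, j ∊ S → ¬ PairIn A j k

/-- Elements of the field with the same `A`-predecessors are equal. -/
def IsExtensional (A : M) : Prop :=
  ∀ u v, InField A u → InField A v → (∀ j, PairIn A j u ↔ PairIn A j v) → u = v

/-! ### The theory -/

variable (M) in
/-- `M` is a model of the theory `ZMC_ω`: Zermelo set theory without the Power Set and Choice
axioms, plus finite-closed supersets, transitive supersets, Mostowski Collapse, and
"all sets are countable". -/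
structure ModelsZMC : Prop where
  extensionality : ∀ x y : M, (∀ z, z ∊ x ↔ z ∊ y) → x = y
  pairing : ∀ x y : M, ∃ z, IsUPair z x y
  union : ∀ X : M, ∃ U, ∀ z, z ∊ U ↔ ∃ y, y ∊ X ∧ z ∊ y
  infinity : ∃ I : M, IsInductive I
  regularity : ∀ X : M, (∃ x, x ∊ X) → ∃ x, x ∊ X ∧ ∀ y, y ∊ X → ¬ y ∊ x
  /-- The Separation schema, for all first-order formulas `φ` with parameters `p`. -/
  separation : ∀ (n : ℕ) (φ : setLang.Formula (Fin (n + 1))) (p : Fin n → M) (X : M),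
    ∃ Y, ∀ x, x ∊ Y ↔ x ∊ X ∧ φ.Realize (Fin.cons x p : Fin (n + 1) → M)
  finiteClosure : ∀ X : M, ∃ Y, Sub X Y ∧ IsFinClosed Y
  transitiveSuperset : ∀ X : M, ∃ Y, Sub X Y ∧ IsTransitive Y
  mostowski : ∀ A : M, IsRel A → IsWellFounded A → IsExtensional A →
    ∃ X F ξ, IsTransitive X ∧ (∀ x, x ∊ F ↔ InField A x) ∧ IsBij ξ F X ∧
      ∀ j k x y, PairIn ξ j x → PairIn ξ k y → (PairIn A j k ↔ x ∊ y)
  countability : ∀ X : M, ∃ f, IsFun f X ∧ IsInj f ∧ ∀ x n, PairIn f x n → IsNat n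

/-! ### Formulas coded by sets

As usual, formulas are coded by hereditarily finite sets, with the connectives `¬`, `∧`, `∃`.
We speak of a formula *in the context* `n ∈ ω`, when its free variables are among
`v_0, …, v_{n-1}`; a quantifier read in the context `n` binds `v_n`, and its body is read in the
context `n + 1`.  (Every formula has this form up to renaming of bound variables.)
-/

/-- `φ` is the code of `v_i ∈ v_j`. -/
def IsMemCode (φ i j : M) : Prop := ∃ t, IsNumeral 0 t ∧ IsTriple φ t i j

/-- `φ` is the code of `v_i = v_j`. -/
def IsEqCode (φ i j : M) : Prop := ∃ t, IsNumeral 1 t ∧ IsTriple φ t i j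

/-- `φ` is the code of `¬ ψ`. -/
def IsNegCode (φ ψ : M) : Prop := ∃ t, IsNumeral 2 t ∧ IsPair φ t ψ

/-- `φ` is the code of `ψ ∧ χ`. -/
def IsAndCode (φ ψ χ : M) : Prop := ∃ t, IsNumeral 3 t ∧ IsTriple φ t ψ χ

/-- `φ` is the code of `∃ v_n ψ`, where `n` is the context of `φ`. -/
def IsExCode (φ ψ : M) : Prop := ∃ t, IsNumeral 4 t ∧ IsPair φ t ψ

/-- `F` is closed under the formation rules for pairs `⟨n, φ⟩`, `φ` a formula in the
context `n`. -/
def IsFormClosed (F : M) : Prop :=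
  (∀ n i j φ, IsNat n → i ∊ n → j ∊ n → IsMemCode φ i j ∨ IsEqCode φ i j → PairIn F n φ) ∧
  (∀ n φ ψ, PairIn F n ψ → IsNegCode φ ψ → PairIn F n φ) ∧
  (∀ n φ ψ χ, PairIn F n ψ → PairIn F n χ → IsAndCode φ ψ χ → PairIn F n φ) ∧
  (∀ n n' φ ψ, IsSucc n' n → PairIn F n' ψ → IsExCode φ ψ → PairIn F n φ)

/-- `φ` is (the code of) a formula in the context `n`: the pair `⟨n, φ⟩` belongs to every set
closed under the formation rules (any finite-closed superset of `ω` is such a set). -/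
def IsForm (n φ : M) : Prop := ∀ F, IsFormClosed F → PairIn F n φ

/-! ### Truth and definability over a set -/

/-- `D`, a set of pairs `⟨n, φ⟩` as above, is closed under immediate subformulas. -/
def IsSubformulaClosed (D : M) : Prop :=
  (∀ n φ ψ, PairIn D n φ → IsNegCode φ ψ → PairIn D n ψ) ∧
  (∀ n φ ψ χ, PairIn D n φ → IsAndCode φ ψ χ → PairIn D n ψ ∧ PairIn D n χ) ∧
  (∀ n n' φ ψ, PairIn D n φ → IsExCode φ ψ → IsSucc n' n → PairIn D n' ψ)

/-- `s` is a sequence of length `n` of elements of `X`. -/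
def IsSeq (X n s : M) : Prop := IsFun s n ∧ ∀ i x, PairIn s i x → x ∊ X

/-- `s' = s ∪ {⟨n, x⟩}`. -/
def IsExt (s' s n x : M) : Prop := ∀ p, p ∊ s' ↔ p ∊ s ∨ IsPair p n x

/-- `⟨n, ⟨φ, s⟩⟩ ∈ τ`: according to `τ`, the closed formula `φ(s_0, …, s_{n-1})`, that is, `φ`
with the elements of the sequence `s` of length `n` substituted as parameters, is true. -/
def TrueBy (τ n φ s : M) : Prop := ∃ t, IsTriple t n φ s ∧ t ∊ τ

/-- `τ` is a Tarski truth set over `X` for the set `D` of formulas: it satisfies the Tarski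
conditions for all formulas in `D` with parameters in `X`. -/
def IsTruthSet (X D τ : M) : Prop :=
  (∀ n φ s i j, PairIn D n φ → IsSeq X n s → IsMemCode φ i j →
    (TrueBy τ n φ s ↔ ∃ x y, PairIn s i x ∧ PairIn s j y ∧ x ∊ y)) ∧
  (∀ n φ s i j, PairIn D n φ → IsSeq X n s → IsEqCode φ i j →
    (TrueBy τ n φ s ↔ ∃ x y, PairIn s i x ∧ PairIn s j y ∧ x = y)) ∧
  (∀ n φ s ψ, PairIn D n φ → IsSeq X n s → IsNegCode φ ψ →
    (TrueBy τ n φ s ↔ ¬ TrueBy τ n ψ s)) ∧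
  (∀ n φ s ψ χ, PairIn D n φ → IsSeq X n s → IsAndCode φ ψ χ →
    (TrueBy τ n φ s ↔ TrueBy τ n ψ s ∧ TrueBy τ n χ s)) ∧
  (∀ n n' φ s ψ, PairIn D n φ → IsSeq X n s → IsExCode φ ψ → IsSucc n' n →
    (TrueBy τ n φ s ↔ ∃ x s', x ∊ X ∧ IsExt s' s n x ∧ TrueBy τ n' ψ s'))

/-- `X ⊨ φ(s_0, …, s_{n-1})`, for a formula `φ` in the context `n` and a sequence `s` of length
`n` of elements of `X`: this closed formula belongs to some Tarski truth set. -/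
def Sat (X n φ s : M) : Prop :=
  ∃ D τ, (∀ m ψ, PairIn D m ψ → IsForm m ψ) ∧ IsSubformulaClosed D ∧ PairIn D n φ ∧
    IsTruthSet X D τ ∧ TrueBy τ n φ s

/-- `Y = {y ∈ X : X ⊨ φ(s_0, …, s_{n-1}, y)}` for some formula `φ` and some finite sequence `s`
of parameters, all of which are elements of `X` satisfying `P`. -/
def DefinableFrom (X : M) (P : M → Prop) (Y : M) : Prop :=
  ∃ n n' φ s, IsNat n ∧ IsSucc n' n ∧ IsForm n' φ ∧ IsSeq X n s ∧ (∀ i x, PairIn s i x → P x) ∧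
    ∀ y, y ∊ Y ↔ y ∊ X ∧ ∃ s', IsExt s' s n y ∧ Sat X n' φ s'

/-- `D = Def X`, the set of all sets definable over `X` with parameters in `X`. -/
def IsDef (D X : M) : Prop := ∀ Y, Y ∊ D ↔ DefinableFrom X (fun _ => True) Y

/-! ### Ordinals and the constructible hierarchy -/

/-- `α` is an ordinal: a transitive set linearly ordered by `∈`
(the order is strict and well-founded by Regularity). -/
def IsOrd (α : M) : Prop :=
  IsTransitive α ∧ ∀ x y, x ∊ α → y ∊ α → x ∊ y ∨ x = y ∨ y ∊ x

/-- `α` is a limit ordinal. -/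
def IsLimitOrd (α : M) : Prop := IsOrd α ∧ ¬ IsEmptySet α ∧ ¬ ∃ β, IsSucc α β

/-- `f` is a function with domain the ordinal `δ`, satisfying the recursion
`f(0) = ∅`, `f(γ + 1) = Def f(γ)`, `f(β) = ⋃_{γ < β} f(γ)` for limit `β`. -/
def IsLSequence (f δ : M) : Prop :=
  IsOrd δ ∧ IsFun f δ ∧ ∀ β y, PairIn f β y →
    (IsEmptySet β → IsEmptySet y) ∧
    (∀ γ z, IsSucc β γ → PairIn f γ z → IsDef y z) ∧
    (IsLimitOrd β → ∀ w, w ∊ y ↔ ∃ γ z, γ ∊ β ∧ PairIn f γ z ∧ w ∊ z)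

/-- `x = L_α`: there is a sequence `⟨L_β : β ≤ α⟩` obeying the recursion, with last term `x`.
Thus "`L_α` exists" is `∃ x, IsL α x`. -/
def IsL (α x : M) : Prop :=
  IsOrd α ∧ ∃ δ f, IsSucc δ α ∧ IsLSequence f δ ∧ PairIn f α x

/-- `x ∈ L = ⋃_α L_α`. -/
def IsConstructible (x : M) : Prop := ∃ α y, IsL α y ∧ x ∊ y

end PowerlessSet

/-!
The levels `L_α` are built by recursion on `α` inside a theory that has neither Power Set nor
Replacement. What makes the recursion work is a weak form of Replacement, `exists_range`: the
range of a definable partial function on a set is a set, *provided that range is transitive*.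
Since the domain is countable, each value has a first preimage; the relation "the value of `c` is
an element of the value of `d`" between these first preimages is a set by Separation, it is
well-founded and extensional, and its Mostowski collapse is the range, except possibly for the element
`∅`.

The successor step applies this to the function sending a formula with parameters in `L_γ` to the
set it defines: its domain is a set because finite-closed supersets provide a set containing the
formulas and the finite sequences in `L_γ`, and its range `Def L_γ` is transitive. In the limit
step no set containing all the parameters is available beforehand. But by `IsL.exists_lDefinable`
every element of an earlier level is definable over some `L_γ` from parameters of the form `L_δ`
with `δ < γ`, so it is named by `γ`, a formula, and a finite sequence of ordinals, and these names
again form a set.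

For this elimination of parameters, let `p ∈ L_α` be defined over `L_γ`, `γ < α`, from earlier
levels. Relativizing the definition to `L_γ` defines `{p}` over `L_α` from `L_γ` and the same
levels (`LDefinable.pointDefinable`). Hence each parameter of a definition over `L_α` can be
replaced by a bound variable subject to such a definition; one parameter is removed at a time
(`exists_eliminate`), by an induction of the model on their number. Formulas, and the numbers of
parameters, are those of the model and may be nonstandard, so relativization and renaming of
variables are proved possible by induction on formulas inside the model (`exists_translation`).
Tarski's conditions for satisfaction, on which all this rests, come from the existence and
uniqueness of truth sets (`exists_evaluates`, `Evaluates.unique`).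

Every induction inside the model is an instance of Separation, so the property in question has to
be first-order definable. The class `Dfb` lets instance search verify this from the form of the
property.
-/

namespace PowerlessSet

set_option linter.unusedSectionVars false

open FirstOrder Language

section Definability

variable {M : Type*} [setLang.Structure M] {n m : ℕ}

/-! ### Predicates definable with parameters -/

/-- The predicate `P` on `n`-tuples of elements of `M` is first-order definable with parameters.
Elements of `M` serve as the names of the parameters.  This is a class, so that instance search
can derive the definability of a predicate from the way it is written. -/
class Dfb (P : (Fin n → M) → Prop) : Prop where
  out : ∃ θ : setLang.BoundedFormula M n, ∀ w, θ.Realize id w ↔ P w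

/-- `t` is a definable function of `n` arguments: its graph, with the value as the last coordinate,
is definable. -/
class DTm (t : (Fin n → M) → M) : Prop where
  out : Dfb (fun w : Fin (n + 1) → M => w (Fin.last n) = t (Fin.init w))

/-- `p` selects some of the coordinates of an `n`-tuple. -/
class IsProj (p : (Fin n → M) → (Fin m → M)) : Prop where
  out : ∃ σ : Fin m → Fin n, ∀ w i, p w i = w (σ i)

instance : IsProj (fun w : Fin n → M => w) := ⟨id, fun _ _ => rfl⟩

instance {p : (Fin n → M) → (Fin (m + 1) → M)} [h : IsProj p] :
    IsProj (fun w => Fin.init (p w)) := by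
  obtain ⟨σ, hσ⟩ := h.out
  exact ⟨fun i => σ i.castSucc, fun w i => by simp [Fin.init, hσ]⟩

-- The preceding instance does not unify with the eta-reduced form of this case.
instance : IsProj (fun w : Fin (n + 1) → M => Fin.init w) := ⟨Fin.castSucc, fun _ _ => rfl⟩

theorem Dfb.congr {P Q : (Fin n → M) → Prop} (hP : Dfb P) (h : ∀ w, P w ↔ Q w) : Dfb Q := by
  obtain ⟨θ, hθ⟩ := hP.out
  exact ⟨θ, fun w => (hθ w).trans (h w)⟩

theorem Dfb.reindex {P : (Fin m → M) → Prop} (hP : Dfb P) (p : (Fin n → M) → (Fin m → M))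
    [hp : IsProj p] : Dfb (fun w => P (p w)) := by
  obtain ⟨θ, hθ⟩ := hP.out
  obtain ⟨σ, hσ⟩ := hp.out
  refine ⟨BoundedFormula.relabel (n := n) (k := 0) (Sum.map id σ) θ.toFormula, fun w => ?_⟩
  rw [← hθ]
  refine (BoundedFormula.realize_relabel (m := n) (n := 0) (xs := w)).trans ?_
  have e : w ∘ (Fin.natAdd n : Fin 0 → Fin (n + 0)) = default := Subsingleton.elim _ _
  rw [e]
  refine BoundedFormula.realize_toFormula θ _ |>.trans ?_
  have h1 : (Sum.elim id (w ∘ Fin.castAdd 0) ∘ Sum.map id σ) ∘ Sum.inl = (id : M → M) := rfl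
  have h2 : (Sum.elim id (w ∘ Fin.castAdd 0) ∘ Sum.map (id : M → M) σ) ∘ Sum.inr = p w := by
    funext i
    simp [hσ]
  rw [h1, h2]

/-! The priorities make instance search decompose a predicate by its logical form before it tries
the predicates of set theory.  Negation is covered as implication of the constant `False`. -/

instance (priority := 2000) instDfbImp {P Q : (Fin n → M) → Prop} [hP : Dfb P] [hQ : Dfb Q] :
    Dfb (fun w => P w → Q w) := by
  obtain ⟨θ, hθ⟩ := hP.out
  obtain ⟨η, hη⟩ := hQ.out
  exact ⟨θ.imp η, fun w => by simp [hθ, hη]⟩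

instance (priority := 2000) {P Q : (Fin n → M) → Prop} [hP : Dfb P] [hQ : Dfb Q] :
    Dfb (fun w => P w ∧ Q w) := by
  obtain ⟨θ, hθ⟩ := hP.out
  obtain ⟨η, hη⟩ := hQ.out
  exact ⟨θ ⊓ η, fun w => by simp [hθ, hη]⟩

instance (priority := 2000) {P Q : (Fin n → M) → Prop} [hP : Dfb P] [hQ : Dfb Q] :
    Dfb (fun w => P w ∨ Q w) := by
  obtain ⟨θ, hθ⟩ := hP.out
  obtain ⟨η, hη⟩ := hQ.out
  exact ⟨θ ⊔ η, fun w => by simp [hθ, hη]⟩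

instance (priority := 2000) {P Q : (Fin n → M) → Prop} [hP : Dfb P] [hQ : Dfb Q] :
    Dfb (fun w => P w ↔ Q w) := by
  obtain ⟨θ, hθ⟩ := hP.out
  obtain ⟨η, hη⟩ := hQ.out
  exact ⟨θ.iff η, fun w => by simp [hθ, hη]⟩

instance (priority := 2000) instDfbForall {P : (Fin n → M) → M → Prop}
    [hP : Dfb (fun w : Fin (n + 1) → M => P (Fin.init w) (w (Fin.last n)))] :
    Dfb (fun w => ∀ x, P w x) := by
  obtain ⟨θ, hθ⟩ := hP.out
  exact ⟨θ.all, fun w => by simp [hθ]⟩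

instance (priority := 2000) instDfbExists {P : (Fin n → M) → M → Prop}
    [hP : Dfb (fun w : Fin (n + 1) → M => P (Fin.init w) (w (Fin.last n)))] :
    Dfb (fun w => ∃ x, P w x) := by
  obtain ⟨θ, hθ⟩ := hP.out
  exact ⟨θ.ex, fun w => by simp [hθ]⟩

instance (priority := 10) (p : Prop) : Dfb (fun _ : Fin n → M => p) := by
  by_cases h : p
  · exact ⟨⊤, fun w => by simp [h]⟩
  · exact ⟨⊥, fun w => by simp [h]⟩

theorem dfb_var_mem (i j : Fin n) : Dfb (fun w : Fin n → M => w i ∊ w j) :=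
  ⟨Relations.boundedFormula₂ (L := setLang) MemSymbol.mem (.var (.inr i)) (.var (.inr j)),
    fun _ => BoundedFormula.realize_rel₂⟩

theorem dfb_var_eq (i j : Fin n) : Dfb (fun w : Fin n → M => w i = w j) :=
  ⟨Term.bdEqual (.var (.inr i)) (.var (.inr j)),
    fun w => by rw [BoundedFormula.realize_bdEqual]; rfl⟩

instance instDTmConst (c : M) : DTm (fun _ : Fin n → M => c) :=
  ⟨⟨Term.bdEqual (.var (.inr (Fin.last n))) (.var (.inl c)),
    fun w => by rw [BoundedFormula.realize_bdEqual]; rfl⟩⟩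

instance (priority := 2000) instDTmProj {p : (Fin n → M) → (Fin m → M)} [hp : IsProj p]
    (i : Fin m) : DTm (fun w => p w i) := by
  obtain ⟨σ, hσ⟩ := hp.out
  refine ⟨?_⟩
  simp only [hσ]
  exact dfb_var_eq (Fin.last n) (σ i).castSucc

/-- Substitution of a definable function for the last argument of a definable predicate. -/
theorem Dfb.substLast {P : (Fin (n + 1) → M) → Prop} (hP : Dfb P) (t : (Fin n → M) → M)
    [ht : DTm t] : Dfb (fun w => P (Fin.snoc w (t w))) := by
  have h : Dfb (fun w : Fin (n + 1) → M => w (Fin.last n) = t (Fin.init w) ∧ P w) := by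
    have := ht.out
    infer_instance
  obtain ⟨θ, hθ⟩ := h.out
  exact ⟨θ.ex, fun w => by simp [hθ]⟩

theorem DTm.reindex {t : (Fin m → M) → M} (ht : DTm t) (p : (Fin n → M) → (Fin m → M))
    [hp : IsProj p] : DTm (fun w => t (p w)) := by
  obtain ⟨σ, hσ⟩ := hp.out
  have : IsProj (fun w : Fin (n + 1) → M =>
      (Fin.snoc (p (Fin.init w)) (w (Fin.last n)) : Fin (m + 1) → M)) := by
    refine ⟨Fin.lastCases (Fin.last n) (fun i => (σ i).castSucc), fun w i => ?_⟩
    refine Fin.lastCases ?_ (fun i => ?_) i <;> simp [hσ, Fin.init]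
  refine ⟨(ht.out.reindex (fun w : Fin (n + 1) → M =>
      (Fin.snoc (p (Fin.init w)) (w (Fin.last n)) : Fin (m + 1) → M))).congr fun w => ?_⟩
  simp

theorem Dfb.substAppend {k : ℕ} {P : (Fin (n + k) → M) → Prop} (hP : Dfb P)
    (t : Fin k → (Fin n → M) → M) (ht : ∀ i, DTm (t i)) :
    Dfb (fun w => P (Fin.append w (fun i => t i w))) := by
  induction k with
  | zero => exact hP.congr fun w => by rw [Fin.append_right_nil _ _ rfl]; rfl
  | succ k ih =>
    have : IsProj (fun (u : Fin (n + k) → M) (i : Fin n) => u (Fin.castAdd k i)) :=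
      ⟨_, fun _ _ => rfl⟩
    have := (ht (Fin.last k)).reindex (fun (u : Fin (n + k) → M) i => u (Fin.castAdd k i))
    have h := ih (hP.substLast (fun u : Fin (n + k) → M =>
      t (Fin.last k) (fun i => u (Fin.castAdd k i)))) (fun i => t i.castSucc) fun i => ht _
    refine h.congr fun w => iff_of_eq (congrArg P ?_)
    simp only [Fin.append_left]
    rw [← Fin.append_snoc]
    congr 1
    funext i
    refine Fin.lastCases ?_ (fun i => ?_) i <;> simp

/-- Substitution of definable functions for the arguments of a definable predicate. -/
theorem Dfb.subst {k : ℕ} {P : (Fin k → M) → Prop} (hP : Dfb P)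
    (t : Fin k → (Fin n → M) → M) (ht : ∀ i, DTm (t i)) :
    Dfb (fun w => P (fun i => t i w)) := by
  have : IsProj (fun (u : Fin (n + k) → M) (i : Fin k) => u (Fin.natAdd n i)) :=
    ⟨_, fun _ _ => rfl⟩
  exact ((hP.reindex (fun (u : Fin (n + k) → M) i => u (Fin.natAdd n i))).substAppend t ht).congr
    fun w => by simp

theorem Dfb.subst1 {R : M → Prop} (h : Dfb (fun w : Fin 1 → M => R (w 0)))
    (a : (Fin n → M) → M) [ha : DTm a] : Dfb (fun w => R (a w)) :=
  h.subst ![a] (fun i => by fin_cases i; assumption)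

theorem Dfb.subst2 {R : M → M → Prop} (h : Dfb (fun w : Fin 2 → M => R (w 0) (w 1)))
    (a b : (Fin n → M) → M) [ha : DTm a] [hb : DTm b] : Dfb (fun w => R (a w) (b w)) :=
  h.subst ![a, b] (fun i => by fin_cases i <;> assumption)

theorem Dfb.subst3 {R : M → M → M → Prop} (h : Dfb (fun w : Fin 3 → M => R (w 0) (w 1) (w 2)))
    (a b c : (Fin n → M) → M) [ha : DTm a] [hb : DTm b] [hc : DTm c] :
    Dfb (fun w => R (a w) (b w) (c w)) :=
  h.subst ![a, b, c] (fun i => by fin_cases i <;> assumption)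

theorem Dfb.subst4 {R : M → M → M → M → Prop}
    (h : Dfb (fun w : Fin 4 → M => R (w 0) (w 1) (w 2) (w 3)))
    (a b c d : (Fin n → M) → M) [ha : DTm a] [hb : DTm b] [hc : DTm c] [hd : DTm d] :
    Dfb (fun w => R (a w) (b w) (c w) (d w)) :=
  h.subst ![a, b, c, d] (fun i => by fin_cases i <;> assumption)

theorem DTm.mk1 {F : M → M} (h : Dfb (fun w : Fin 2 → M => w 1 = F (w 0)))
    (a : (Fin n → M) → M) [ha : DTm a] : DTm (fun w => F (a w)) := by
  have := ha.reindex (fun w : Fin (n + 1) → M => Fin.init w)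
  exact ⟨Dfb.subst2 (R := fun x y => y = F x) h (fun w => a (Fin.init w)) (fun w => w (Fin.last n))⟩

theorem DTm.mk2 {F : M → M → M} (h : Dfb (fun w : Fin 3 → M => w 2 = F (w 0) (w 1)))
    (a b : (Fin n → M) → M) [ha : DTm a] [hb : DTm b] : DTm (fun w => F (a w) (b w)) := by
  have := ha.reindex (fun w : Fin (n + 1) → M => Fin.init w)
  have := hb.reindex (fun w : Fin (n + 1) → M => Fin.init w)
  exact ⟨Dfb.subst3 (R := fun x y z => z = F x y) h (fun w => a (Fin.init w))
    (fun w => b (Fin.init w)) (fun w => w (Fin.last n))⟩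

theorem DTm.mk3 {F : M → M → M → M} (h : Dfb (fun w : Fin 4 → M => w 3 = F (w 0) (w 1) (w 2)))
    (a b c : (Fin n → M) → M) [ha : DTm a] [hb : DTm b] [hc : DTm c] :
    DTm (fun w => F (a w) (b w) (c w)) := by
  have := ha.reindex (fun w : Fin (n + 1) → M => Fin.init w)
  have := hb.reindex (fun w : Fin (n + 1) → M => Fin.init w)
  have := hc.reindex (fun w : Fin (n + 1) → M => Fin.init w)
  exact ⟨Dfb.subst4 (R := fun x y z u => u = F x y z) h (fun w => a (Fin.init w))
    (fun w => b (Fin.init w)) (fun w => c (Fin.init w)) (fun w => w (Fin.last n))⟩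

section Instances

set_option synthInstance.maxHeartbeats 200000
set_option synthInstance.maxSize 1000

variable (a b c d : (Fin n → M) → M) [DTm a] [DTm b] [DTm c] [DTm d]

instance (priority := 2000) instDfbMem : Dfb (fun w => a w ∊ b w) := (dfb_var_mem 0 1).subst2 a b
instance (priority := 2000) instDfbEq : Dfb (fun w => a w = b w) :=
  Dfb.subst2 (R := (· = ·)) (dfb_var_eq 0 1) a b

instance : Dfb (fun w => Sub (a w) (b w)) := Dfb.subst2 (by unfold Sub; infer_instance) a b
instance : Dfb (fun w => IsEmptySet (a w)) := Dfb.subst1 (by unfold IsEmptySet; infer_instance) a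
instance : Dfb (fun w => IsUPair (a w) (b w) (c w)) :=
  Dfb.subst3 (by unfold IsUPair; infer_instance) a b c
instance : Dfb (fun w => IsPair (a w) (b w) (c w)) :=
  Dfb.subst3 (by unfold IsPair; infer_instance) a b c
instance : Dfb (fun w => IsTriple (a w) (b w) (c w) (d w)) :=
  Dfb.subst4 (by unfold IsTriple; infer_instance) a b c d
instance : Dfb (fun w => IsSucc (a w) (b w)) := Dfb.subst2 (by unfold IsSucc; infer_instance) a b
instance : Dfb (fun w => IsTransitive (a w)) :=
  Dfb.subst1 (by unfold IsTransitive; infer_instance) a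
instance : Dfb (fun w => IsInductive (a w)) := Dfb.subst1 (by unfold IsInductive; infer_instance) a
instance : Dfb (fun w => IsNat (a w)) := Dfb.subst1 (by unfold IsNat; infer_instance) a
instance : Dfb (fun w => PairIn (a w) (b w) (c w)) :=
  Dfb.subst3 (by unfold PairIn; infer_instance) a b c
instance : Dfb (fun w => IsRel (a w)) := Dfb.subst1 (by unfold IsRel; infer_instance) a
instance : Dfb (fun w => IsFun (a w) (b w)) := Dfb.subst2 (by unfold IsFun; infer_instance) a b
instance : Dfb (fun w => IsInj (a w)) := Dfb.subst1 (by unfold IsInj; infer_instance) a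
instance : Dfb (fun w => IsBij (a w) (b w) (c w)) :=
  Dfb.subst3 (by unfold IsBij; infer_instance) a b c
instance : Dfb (fun w => IsFin (a w)) := Dfb.subst1 (by unfold IsFin; infer_instance) a

theorem dfb_isNumeral (k : ℕ) : Dfb (fun w : Fin 1 → M => IsNumeral k (w 0)) := by
  induction k with
  | zero => unfold IsNumeral; infer_instance
  | succ k ih =>
    have (m : ℕ) (a : (Fin m → M) → M) [DTm a] : Dfb (fun w => IsNumeral k (a w)) := ih.subst1 a
    unfold IsNumeral
    infer_instance

instance (k : ℕ) : Dfb (fun w => IsNumeral k (a w)) := (dfb_isNumeral k).subst1 a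

instance : Dfb (fun w => IsMemCode (a w) (b w) (c w)) :=
  Dfb.subst3 (by unfold IsMemCode; infer_instance) a b c
instance : Dfb (fun w => IsEqCode (a w) (b w) (c w)) :=
  Dfb.subst3 (by unfold IsEqCode; infer_instance) a b c
instance : Dfb (fun w => IsNegCode (a w) (b w)) :=
  Dfb.subst2 (by unfold IsNegCode; infer_instance) a b
instance : Dfb (fun w => IsAndCode (a w) (b w) (c w)) :=
  Dfb.subst3 (by unfold IsAndCode; infer_instance) a b c
instance : Dfb (fun w => IsExCode (a w) (b w)) :=
  Dfb.subst2 (by unfold IsExCode; infer_instance) a b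
instance : Dfb (fun w => IsFormClosed (a w)) :=
  Dfb.subst1 (by unfold IsFormClosed; infer_instance) a
instance : Dfb (fun w => IsForm (a w) (b w)) := Dfb.subst2 (by unfold IsForm; infer_instance) a b
instance : Dfb (fun w => IsSubformulaClosed (a w)) :=
  Dfb.subst1 (by unfold IsSubformulaClosed; infer_instance) a
instance : Dfb (fun w => IsSeq (a w) (b w) (c w)) :=
  Dfb.subst3 (by unfold IsSeq; infer_instance) a b c
instance : Dfb (fun w => IsExt (a w) (b w) (c w) (d w)) :=
  Dfb.subst4 (by unfold IsExt; infer_instance) a b c d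
instance : Dfb (fun w => TrueBy (a w) (b w) (c w) (d w)) :=
  Dfb.subst4 (by unfold TrueBy; infer_instance) a b c d
instance : Dfb (fun w => IsTruthSet (a w) (b w) (c w)) :=
  Dfb.subst3 (by unfold IsTruthSet; infer_instance) a b c
instance : Dfb (fun w => Sat (a w) (b w) (c w) (d w)) :=
  Dfb.subst4 (by unfold Sat; infer_instance) a b c d
instance : Dfb (fun w => DefinableFrom (a w) (fun _ => True) (b w)) :=
  Dfb.subst2 (R := fun x y => DefinableFrom x (fun _ => True) y)
    (by unfold DefinableFrom; infer_instance) a b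
instance : Dfb (fun w => IsDef (a w) (b w)) := Dfb.subst2 (by unfold IsDef; infer_instance) a b
instance : Dfb (fun w => IsOrd (a w)) := Dfb.subst1 (by unfold IsOrd; infer_instance) a
instance : Dfb (fun w => IsLimitOrd (a w)) := Dfb.subst1 (by unfold IsLimitOrd; infer_instance) a
instance : Dfb (fun w => IsLSequence (a w) (b w)) :=
  Dfb.subst2 (by unfold IsLSequence; infer_instance) a b
instance : Dfb (fun w => IsL (a w) (b w)) := Dfb.subst2 (by unfold IsL; infer_instance) a b

end Instances

end Definability

variable {M : Type*} [setLang.Structure M]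

/-! ### Elementary set theory inside a model -/

variable (M) in
/-- The hypothesis that `M` is a model of `ZMC_ω`, as a class. -/
class ZMC : Prop where
  models : ModelsZMC M

variable [ZMC M]

theorem ext_iff {x y : M} : x = y ↔ ∀ z, z ∊ x ↔ z ∊ y :=
  ⟨fun h _ => h ▸ Iff.rfl, ZMC.models.extensionality x y⟩

/-- Separation for definable predicates.  A formula has finitely many parameters; these are
enumerated to match the form of the axiom. -/
theorem exists_sep (P : M → Prop) [hP : Dfb (fun w : Fin 1 → M => P (w 0))] (X : M) :
    ∃ Y, ∀ x, x ∊ Y ↔ x ∊ X ∧ P x := by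
  classical
  obtain ⟨θ, hθ⟩ := hP.out
  let S := θ.toFormula.freeVarFinset
  let e := Fintype.equivFin S
  let p : Fin (Fintype.card S) → M := fun i => Sum.elim id (fun _ => X) (e.symm i).1
  let f : S → Fin (Fintype.card S + 1) := fun a => Sum.elim (fun _ => (e a).succ) (fun _ => 0) a.1
  obtain ⟨Y, hY⟩ := ZMC.models.separation _ (θ.toFormula.restrictFreeVar f) p X
  refine ⟨Y, fun x => (hY x).trans (and_congr_right fun _ => ?_)⟩
  have key : BoundedFormula.Realize (θ.toFormula.restrictFreeVar f) (Fin.cons x p) default ↔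
      BoundedFormula.Realize θ.toFormula (Sum.elim id (fun _ : Fin 1 => x)) default := by
    refine BoundedFormula.realize_restrictFreeVar (Sum.elim id (fun _ : Fin 1 => x)) ?_
    rintro ⟨a | a, ha⟩
    · simp [f, p]
    · simp [f]
  refine key.trans ?_
  refine (BoundedFormula.realize_toFormula θ _).trans ?_
  exact hθ _

/-- `{x ∈ X : P x}` -/
noncomputable def sep (P : M → Prop) [Dfb (fun w : Fin 1 → M => P (w 0))] (X : M) : M :=
  (exists_sep P X).choose

@[simp] theorem mem_sep {P : M → Prop} [Dfb (fun w : Fin 1 → M => P (w 0))] {X x : M} :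
    x ∊ sep P X ↔ x ∊ X ∧ P x := (exists_sep P X).choose_spec x

/-- `{x, y}` -/
noncomputable def upair (x y : M) : M := (ZMC.models.pairing x y).choose

@[simp] theorem mem_upair {x y z : M} : z ∊ upair x y ↔ z = x ∨ z = y :=
  (ZMC.models.pairing x y).choose_spec z

/-- `⋃ X` -/
noncomputable def sUn (X : M) : M := (ZMC.models.union X).choose

@[simp] theorem mem_sUn {X z : M} : z ∊ sUn X ↔ ∃ y, y ∊ X ∧ z ∊ y :=
  (ZMC.models.union X).choose_spec z

variable (M) in
/-- `∅` -/
noncomputable def emp : M := sep (fun _ => False) (ZMC.models (M := M)).infinity.choose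

@[simp] theorem not_mem_emp {x : M} : ¬ x ∊ emp M := by simp [emp]

/-- `x ∪ y` -/
noncomputable def un (x y : M) : M := sUn (upair x y)

@[simp] theorem mem_un {x y z : M} : z ∊ un x y ↔ z ∊ x ∨ z ∊ y := by simp [un]

/-- `x ∪ {x}` -/
noncomputable def succ (x : M) : M := un x (upair x x)

@[simp] theorem mem_succ {x z : M} : z ∊ succ x ↔ z ∊ x ∨ z = x := by simp [succ]

/-- `⟨x, y⟩` -/
noncomputable def pair (x y : M) : M := upair (upair x x) (upair x y)

theorem isEmptySet_iff {x : M} : IsEmptySet x ↔ x = emp M := by simp [ext_iff, IsEmptySet]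
theorem isUPair_iff {x y z : M} : IsUPair z x y ↔ z = upair x y := by simp [ext_iff, IsUPair]
theorem isSucc_iff {x y : M} : IsSucc y x ↔ y = succ x := by simp [ext_iff, IsSucc]
theorem isPair_iff {x y z : M} : IsPair z x y ↔ z = pair x y := by simp [IsPair, isUPair_iff, pair]
theorem isTriple_iff {t x y z : M} : IsTriple t x y z ↔ t = pair x (pair y z) := by
  simp [IsTriple, isPair_iff]
theorem pairIn_iff {f x y : M} : PairIn f x y ↔ pair x y ∊ f := by simp [PairIn, isPair_iff]

theorem eq_emp_or_exists_mem (x : M) : x = emp M ∨ ∃ y, y ∊ x := by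
  by_contra! h
  exact h.1 (isEmptySet_iff.1 h.2)

theorem upair_eq_upair {x y u v : M} :
    upair x y = upair u v ↔ (x = u ∧ y = v) ∨ (x = v ∧ y = u) := by
  rw [ext_iff]
  simp only [mem_upair]
  refine ⟨fun h => ?_, by grind⟩
  have h1 := (h x).1 (.inl rfl)
  have h2 := (h y).1 (.inr rfl)
  have h3 := (h u).2 (.inl rfl)
  have h4 := (h v).2 (.inr rfl)
  clear h
  grind

@[simp] theorem pair_inj {x y x' y' : M} : pair x y = pair x' y' ↔ x = x' ∧ y = y' := by
  simp only [pair, upair_eq_upair]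
  grind

theorem not_mem_self (x : M) : ¬ x ∊ x := by
  obtain ⟨z, hz, h⟩ := ZMC.models.regularity (upair x x) ⟨x, by simp⟩
  simp only [mem_upair, or_self] at hz
  subst hz
  exact h z (by simp)

theorem mem_asymm {x y : M} (h : x ∊ y) : ¬ y ∊ x := by
  intro h'
  obtain ⟨z, hz, hz'⟩ := ZMC.models.regularity (upair x y) ⟨x, by simp⟩
  simp only [mem_upair] at hz hz'
  rcases hz with rfl | rfl
  · exact hz' y (.inr rfl) h'
  · exact hz' x (.inl rfl) h

/-- `∈`-induction for definable properties: it follows from Regularity and the existence of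
transitive supersets. -/
theorem mem_induction (P : M → Prop) [Dfb (fun w : Fin 1 → M => P (w 0))]
    (h : ∀ x, (∀ y, y ∊ x → P y) → P x) (x : M) : P x := by
  by_contra hx
  obtain ⟨T, hT, hT'⟩ := ZMC.models.transitiveSuperset (upair x x)
  obtain ⟨z, hz, hz'⟩ := ZMC.models.regularity (sep (fun y => ¬ P y) T) ⟨x, by
    simpa [hx] using hT x (by simp)⟩
  simp only [mem_sep] at hz hz'
  refine hz.2 (h z fun y hy => ?_)
  by_contra hy'
  exact hz' y ⟨hT' z hz.1 y hy, hy'⟩ hy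

theorem mem_irrefl3 {x y z : M} (h1 : x ∊ y) (h2 : y ∊ z) : ¬ z ∊ x := by
  intro h3
  obtain ⟨u, hu, hu'⟩ := ZMC.models.regularity (un (upair x y) (upair z z)) ⟨x, by simp⟩
  simp only [mem_un, mem_upair, or_self] at hu hu'
  rcases hu with (rfl | rfl) | rfl
  · exact hu' z (.inr rfl) h3
  · exact hu' x (.inl (.inl rfl)) h1
  · exact hu' y (.inl (.inr rfl)) h2

theorem succ_inj {x y : M} (h : succ x = succ y) : x = y := by
  have h1 : x ∊ succ y := h ▸ (by simp)
  have h2 : y ∊ succ x := h ▸ (by simp)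
  simp only [mem_succ] at h1 h2
  rcases h1 with h1 | h1
  · rcases h2 with h2 | h2
    · exact absurd h2 (mem_asymm h1)
    · exact h2.symm
  · exact h1

@[simp] theorem succ_ne_emp {x : M} : succ x ≠ emp M := fun h =>
  not_mem_emp (M := M) (x := x) (h ▸ (by simp))

/-! ### Ordinals -/

theorem IsOrd.mem {α β : M} (h : IsOrd α) (hb : β ∊ α) : IsOrd β := by
  refine ⟨fun y hy z hz => ?_, fun x y hx hy => h.2 x y (h.1 β hb x hx) (h.1 β hb y hy)⟩
  have hy' := h.1 β hb y hy
  rcases h.2 z β (h.1 y hy' z hz) hb with h1 | rfl | h1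
  · exact h1
  · exact absurd hz (mem_asymm hy)
  · exact absurd h1 (mem_irrefl3 hz hy)

theorem IsOrd.trichotomy {α β : M} (ha : IsOrd α) (hb : IsOrd β) : α ∊ β ∨ α = β ∨ β ∊ α := by
  suffices H : ∀ α : M, IsOrd α → ∀ β, IsOrd β → (α ∊ β ∨ α = β ∨ β ∊ α) from H α ha β hb
  refine mem_induction (fun α => IsOrd α → ∀ β, IsOrd β → (α ∊ β ∨ α = β ∨ β ∊ α)) ?_
  intro α iha ha
  refine mem_induction (fun β => IsOrd β → (α ∊ β ∨ α = β ∨ β ∊ α)) ?_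
  intro β ihb hb
  by_contra! hn
  refine hn.2.1 (ext_iff.2 fun z => ⟨fun hz => ?_, fun hz => ?_⟩)
  · rcases iha z hz (ha.mem hz) β hb with h | rfl | h
    · exact h
    · exact absurd hz hn.2.2
    · exact absurd (ha.1 z hz β h) hn.2.2
  · rcases ihb z hz (hb.mem hz) with h | rfl | h
    · exact absurd (hb.1 z hz α h) hn.1
    · exact absurd hz hn.1
    · exact h

theorem isOrd_emp : IsOrd (emp M) := ⟨by simp [IsTransitive], by simp⟩

theorem IsOrd.succ {α : M} (h : IsOrd α) : IsOrd (succ α) := by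
  refine ⟨fun y hy z hz => ?_, fun x y hx hy => ?_⟩
  · simp only [mem_succ] at hy ⊢
    rcases hy with hy | rfl
    · exact .inl (h.1 y hy z hz)
    · exact .inl hz
  · have hx' : IsOrd x := by
      rcases mem_succ.1 hx with hx | rfl
      exacts [h.mem hx, h]
    have hy' : IsOrd y := by
      rcases mem_succ.1 hy with hy | rfl
      exacts [h.mem hy, h]
    exact hx'.trichotomy hy'

/-- Every ordinal is zero, a successor, or a limit. -/
theorem IsOrd.cases {α : M} (h : IsOrd α) :
    α = emp M ∨ (∃ β, IsOrd β ∧ α = PowerlessSet.succ β) ∨ IsLimitOrd α := by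
  by_cases h0 : α = emp M
  · exact .inl h0
  · by_cases h1 : ∃ β, α = PowerlessSet.succ β
    · obtain ⟨β, rfl⟩ := h1
      exact .inr (.inl ⟨β, h.mem (by simp), rfl⟩)
    · exact .inr (.inr ⟨h, by rwa [isEmptySet_iff], by simpa [isSucc_iff] using h1⟩)

theorem IsLimitOrd.succ_mem {α β : M} (h : IsLimitOrd α) (hb : β ∊ α) : succ β ∊ α := by
  rcases ((h.1.mem hb).succ).trichotomy h.1 with h1 | h1 | h1
  · exact h1
  · exact absurd ⟨β, isSucc_iff.2 h1.symm⟩ h.2.2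
  · rcases mem_succ.1 h1 with h1 | rfl
    · exact absurd h1 (mem_asymm hb)
    · exact absurd hb (not_mem_self _)

/-! ### Natural numbers -/

theorem isInductive_iff {I : M} :
    IsInductive I ↔ emp M ∊ I ∧ ∀ x, x ∊ I → succ x ∊ I := by
  simp [IsInductive, isEmptySet_iff, isSucc_iff]

theorem isNat_emp : IsNat (emp M) := fun _ hI => (isInductive_iff.1 hI).1

theorem IsNat.succ {n : M} (h : IsNat n) : IsNat (succ n) :=
  fun I hI => (isInductive_iff.1 hI).2 n (h I hI)

variable (M) in
/-- `ω` -/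
noncomputable def omega : M := sep IsNat (ZMC.models (M := M)).infinity.choose

@[simp] theorem mem_omega {n : M} : n ∊ omega M ↔ IsNat n := by
  rw [omega, mem_sep]
  exact ⟨fun h => h.2, fun h => ⟨h _ (ZMC.models (M := M)).infinity.choose_spec, h⟩⟩

theorem nat_induction (P : M → Prop) [Dfb (fun w : Fin 1 → M => P (w 0))] (h0 : P (emp M))
    (hs : ∀ n, IsNat n → P n → P (succ n)) (n : M) (hn : IsNat n) : P n := by
  have : IsInductive (sep P (omega M)) := by
    refine isInductive_iff.2 ⟨by simp [isNat_emp, h0], fun x hx => ?_⟩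
    simp only [mem_sep, mem_omega] at hx ⊢
    exact ⟨hx.1.succ, hs x hx.1 hx.2⟩
  exact (mem_sep.1 (hn _ this)).2

theorem IsNat.isOrd {n : M} (h : IsNat n) : IsOrd n :=
  nat_induction IsOrd isOrd_emp (fun _ _ => IsOrd.succ) n h

theorem IsNat.mem {n i : M} (h : IsNat n) (hi : i ∊ n) : IsNat i := by
  refine nat_induction (fun n => ∀ i, i ∊ n → IsNat i) (by simp) (fun n hn ih i hi => ?_) n h i hi
  rcases mem_succ.1 hi with hi | rfl
  exacts [ih i hi, hn]

/-- The von Neumann numeral of `k`. -/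
noncomputable def num (M : Type*) [setLang.Structure M] [ZMC M] : ℕ → M
  | 0 => emp M
  | k + 1 => succ (num M k)

theorem isNumeral_iff {k : ℕ} {x : M} : IsNumeral k x ↔ x = num M k := by
  induction k generalizing x with
  | zero => simp [IsNumeral, isEmptySet_iff, num]
  | succ k ih => simp [IsNumeral, ih, isSucc_iff, num]

theorem isNat_num (k : ℕ) : IsNat (num M k) := by
  induction k with
  | zero => exact isNat_emp
  | succ k ih => exact ih.succ

@[simp] theorem num_mem_num {k l : ℕ} : num M k ∊ num M l ↔ k < l := by
  induction l generalizing k with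
  | zero => simp [num]
  | succ l ih =>
    simp only [num, mem_succ, ih]
    constructor
    · rintro (h | h)
      · omega
      · by_contra hk
        have : num M l ∊ num M k := by
          clear ih
          obtain ⟨d, rfl⟩ : ∃ d, k = l + 1 + d := ⟨k - (l + 1), by omega⟩
          clear h hk
          induction d with
          | zero => simp [num]
          | succ d ihd => exact mem_succ.2 (.inl ihd)
        exact not_mem_self _ (h ▸ this)
    · intro h
      rcases Nat.lt_succ_iff_lt_or_eq.1 h with h | rfl
      exacts [.inl h, .inr rfl]

@[simp] theorem num_inj {k l : ℕ} : num M k = num M l ↔ k = l := by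
  refine ⟨fun h => ?_, fun h => h ▸ rfl⟩
  rcases Nat.lt_trichotomy k l with h1 | h1 | h1
  · exact absurd (num_mem_num.2 h1) (by rw [h]; exact not_mem_self (num M l))
  · exact h1
  · exact absurd (num_mem_num.2 h1) (by rw [h]; exact not_mem_self (num M l))

/-! ### Definability of the elementary operations -/

section

variable {n : ℕ} (a b : (Fin n → M) → M) [DTm a] [DTm b]

instance : DTm (fun w => upair (a w) (b w)) :=
  DTm.mk2 (by simp only [ext_iff, mem_upair]; infer_instance) a b
instance : DTm (fun w => un (a w) (b w)) :=
  DTm.mk2 (by simp only [ext_iff, mem_un]; infer_instance) a b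
instance : DTm (fun w => succ (a w)) := DTm.mk1 (by simp only [ext_iff, mem_succ]; infer_instance) a
instance : DTm (fun w => pair (a w) (b w)) := DTm.mk2 (by unfold pair; infer_instance) a b

end

/-! ### Functions and finite sequences -/

/-- The value of the function `f` at `x`; it is `∅` unless there is exactly one value. -/
noncomputable def app (f x : M) : M :=
  open Classical in if h : ∃ y, PairIn f x y ∧ ∀ z, PairIn f x z → z = y then h.choose else emp M

theorem eq_app_iff {f x y : M} : y = app f x ↔ (PairIn f x y ∧ ∀ z, PairIn f x z → z = y) ∨
    (¬ (∃ y, PairIn f x y ∧ ∀ z, PairIn f x z → z = y) ∧ y = emp M) := by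
  unfold app
  split_ifs with h
  · have hs := h.choose_spec
    refine ⟨fun e => .inl ?_, ?_⟩
    · rw [e]; exact hs
    · rintro (e | e)
      · exact hs.2 _ e.1
      · exact absurd h e.1
  · simp [h]
    exact fun h1 h2 => absurd ⟨y, h1, h2⟩ h

instance {n : ℕ} (a b : (Fin n → M) → M) [DTm a] [DTm b] : DTm (fun w => app (a w) (b w)) :=
  DTm.mk2 (by simp only [eq_app_iff]; infer_instance) a b

theorem IsFun.app_eq {f a x y : M} (h : IsFun f a) (hxy : PairIn f x y) : app f x = y :=
  (eq_app_iff.2 (.inl ⟨hxy, fun _ hz => h.2.2 _ _ _ hz hxy⟩)).symm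

theorem IsFun.pairIn_iff {f a x y : M} (h : IsFun f a) : PairIn f x y ↔ x ∊ a ∧ app f x = y := by
  refine ⟨fun hp => ⟨(h.2.1 x).2 ⟨y, hp⟩, h.app_eq hp⟩, ?_⟩
  rintro ⟨hx, rfl⟩
  obtain ⟨y, hy⟩ := (h.2.1 x).1 hx
  rwa [h.app_eq hy]

theorem IsFun.mem_iff {f a p : M} (h : IsFun f a) :
    p ∊ f ↔ ∃ x, x ∊ a ∧ p = pair x (app f x) := by
  constructor
  · intro hp
    obtain ⟨x, y, hxy⟩ := h.1 p hp
    rw [isPair_iff] at hxy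
    have := h.pairIn_iff.1 (PowerlessSet.pairIn_iff.2 (hxy ▸ hp))
    exact ⟨x, this.1, by rw [hxy, this.2]⟩
  · rintro ⟨x, hx, rfl⟩
    exact PowerlessSet.pairIn_iff.1 (h.pairIn_iff.2 ⟨hx, rfl⟩)

theorem IsFun.eq_of_app {f g a : M} (hf : IsFun f a) (hg : IsFun g a)
    (h : ∀ x, x ∊ a → app f x = app g x) : f = g := by
  refine ext_iff.2 fun p => ?_
  rw [hf.mem_iff, hg.mem_iff]
  exact exists_congr fun x => and_congr_right fun hx => by rw [h x hx]

/-- `s ∪ {⟨n, x⟩}` -/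
noncomputable def ext (s n x : M) : M := un s (upair (pair n x) (pair n x))

theorem isExt_iff {s' s n x : M} : IsExt s' s n x ↔ s' = ext s n x := by
  simp [IsExt, ext_iff, ext, isPair_iff]

theorem pairIn_ext {s n x i y : M} : PairIn (ext s n x) i y ↔ PairIn s i y ∨ (i = n ∧ y = x) := by
  simp [pairIn_iff, ext]

instance {n : ℕ} (a b c : (Fin n → M) → M) [DTm a] [DTm b] [DTm c] :
    DTm (fun w => ext (a w) (b w) (c w)) :=
  DTm.mk3 (by unfold ext; infer_instance) a b c

theorem isFun_emp : IsFun (emp M) (emp M) := by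
  simp [IsFun, IsRel, pairIn_iff]

theorem IsFun.eq_emp {s : M} (h : IsFun s (emp M)) : s = emp M := by
  rw [ext_iff]
  intro p
  rw [h.mem_iff]
  simp

theorem IsFun.snoc {s n : M} (h : IsFun s n) (x : M) : IsFun (ext s n x) (succ n) := by
  have hn : ∀ y, ¬ PairIn s n y := fun y hy => not_mem_self n ((h.2.1 n).2 ⟨y, hy⟩)
  refine ⟨fun p hp => ?_, fun i => ?_, fun i y z hy hz => ?_⟩
  · simp only [ext, mem_un, mem_upair, or_self] at hp
    rcases hp with hp | rfl
    · exact h.1 p hp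
    · exact ⟨n, x, isPair_iff.2 rfl⟩
  · simp only [mem_succ, pairIn_ext, h.2.1 i]
    constructor
    · rintro (⟨y, hy⟩ | rfl)
      exacts [⟨y, .inl hy⟩, ⟨x, .inr ⟨rfl, rfl⟩⟩]
    · rintro ⟨y, hy | ⟨rfl, rfl⟩⟩
      exacts [.inl ⟨y, hy⟩, .inr rfl]
  · rw [pairIn_ext] at hy hz
    rcases hy with hy | ⟨rfl, rfl⟩
    · rcases hz with hz | ⟨rfl, rfl⟩
      · exact h.2.2 _ _ _ hy hz
      · exact absurd hy (hn _)
    · rcases hz with hz | ⟨-, rfl⟩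
      · exact absurd hz (hn _)
      · rfl

theorem IsFun.app_ext_self {s n x : M} (h : IsFun s n) : app (ext s n x) n = x :=
  (h.snoc x).app_eq (pairIn_ext.2 (.inr ⟨rfl, rfl⟩))

theorem IsFun.app_ext_of_mem {s n x i : M} (h : IsFun s n) (hi : i ∊ n) :
    app (ext s n x) i = app s i :=
  (h.snoc x).app_eq (pairIn_ext.2 (.inl (h.pairIn_iff.2 ⟨hi, rfl⟩)))

theorem IsFun.restrict {f a b : M} (h : IsFun f a) (hb : Sub b a) :
    ∃ g, IsFun g b ∧ ∀ x, x ∊ b → app g x = app f x := by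
  obtain ⟨g, hg⟩ := exists_sep (fun p : M => ∃ i y : M, i ∊ b ∧ p = pair i y) f
  have hg' : ∀ i y, PairIn g i y ↔ i ∊ b ∧ app f i = y := fun i y => by
    rw [PowerlessSet.pairIn_iff, hg]
    simp only [pair_inj]
    rw [← PowerlessSet.pairIn_iff, h.pairIn_iff]
    constructor
    · rintro ⟨⟨-, h1⟩, i', y', h3, rfl, rfl⟩
      exact ⟨h3, h1⟩
    · rintro ⟨h1, h2⟩
      exact ⟨⟨hb i h1, h2⟩, i, y, h1, rfl, rfl⟩
  have hf : IsFun g b := by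
    refine ⟨fun p hp => ?_, fun i => ?_, fun i y z hy hz => ?_⟩
    · obtain ⟨-, i, y, -, rfl⟩ := (hg p).1 hp
      exact ⟨i, y, isPair_iff.2 rfl⟩
    · simp [hg']
    · rw [hg'] at hy hz
      rw [← hy.2, hz.2]
  exact ⟨g, hf, fun x hx => hf.app_eq ((hg' x _).2 ⟨hx, rfl⟩)⟩

theorem IsFun.exists_eq_ext {s n : M} (h : IsFun s (succ n)) :
    ∃ t x, IsFun t n ∧ s = ext t n x := by
  obtain ⟨t, ht, ht'⟩ := h.restrict (b := n) fun x hx => mem_succ.2 (.inl hx)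
  refine ⟨t, app s n, ht, h.eq_of_app (ht.snoc _) fun i hi => ?_⟩
  rcases mem_succ.1 hi with hi | rfl
  · rw [ht.app_ext_of_mem hi, ht' i hi]
  · rw [ht.app_ext_self]

/-! ### Finite sets and finite-closed sets -/

theorem isFin_emp : IsFin (emp M) :=
  ⟨emp M, emp M, isNat_emp, isFun_emp, by simp [IsInj, pairIn_iff], by simp [pairIn_iff]⟩

theorem IsFin.insert {a : M} (h : IsFin a) (x : M) : IsFin (un a (upair x x)) := by
  by_cases hx : x ∊ a
  · rwa [show un a (upair x x) = a by rw [ext_iff]; intro z; simp; rintro rfl; exact hx]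
  obtain ⟨n, f, hn, hf, hi, hs⟩ := h
  refine ⟨succ n, ext f n x, hn.succ, hf.snoc x, fun i j z hi' hj' => ?_, fun y => ?_⟩
  · rw [pairIn_ext] at hi' hj'
    rcases hi' with hi' | ⟨rfl, rfl⟩
    · rcases hj' with hj' | ⟨rfl, rfl⟩
      · exact hi _ _ _ hi' hj'
      · exact absurd ((hs _).2 ⟨_, hi'⟩) hx
    · rcases hj' with hj' | ⟨rfl, -⟩
      · exact absurd ((hs _).2 ⟨_, hj'⟩) hx
      · rfl
  · simp only [mem_un, mem_upair, or_self, pairIn_ext, hs]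
    constructor
    · rintro (⟨i, hi⟩ | rfl)
      exacts [⟨i, .inl hi⟩, ⟨n, .inr ⟨rfl, rfl⟩⟩]
    · rintro ⟨i, hi | ⟨rfl, rfl⟩⟩
      exacts [.inl ⟨i, hi⟩, .inr rfl]

theorem isFin_upair (x y : M) : IsFin (upair x y) := by
  have := (isFin_emp.insert x).insert y
  rwa [show un (un (emp M) (upair x x)) (upair y y) = upair x y by rw [ext_iff]; simp] at this

/-- A function on a natural number is a finite set. -/
theorem IsFun.isFin {n s : M} (hn : IsNat n) (hs : IsFun s n) : IsFin s := by
  refine nat_induction (fun n => ∀ s, IsFun s n → IsFin s) (fun s hs => ?_)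
    (fun n _ ih s hs => ?_) n hn s hs
  · rw [hs.eq_emp]; exact isFin_emp
  · obtain ⟨t, x, ht, rfl⟩ := hs.exists_eq_ext
    exact (ih t ht).insert _

/-- A finite-closed superset of `X`. -/
noncomputable def fc (X : M) : M := (ZMC.models.finiteClosure X).choose

theorem mem_fc {X x : M} (h : x ∊ X) : x ∊ fc X :=
  (ZMC.models.finiteClosure X).choose_spec.1 x h

theorem fc_of_isFin {X x : M} (h : IsFin x) (h' : ∀ y, y ∊ x → y ∊ fc X) : x ∊ fc X :=
  (ZMC.models.finiteClosure X).choose_spec.2 x h' h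

theorem pair_mem_fc {X x y : M} (hx : x ∊ fc X) (hy : y ∊ fc X) : pair x y ∊ fc X := by
  have h (x y : M) (hx : x ∊ fc X) (hy : y ∊ fc X) : upair x y ∊ fc X :=
    fc_of_isFin (isFin_upair x y) (by simp only [mem_upair]; rintro z (rfl | rfl) <;> assumption)
  exact h _ _ (h _ _ hx hx) (h _ _ hx hy)

theorem IsSeq.mem_fc {X Y n s : M} (hn : IsNat n) (hs : IsSeq X n s) (hX : Sub X (fc Y))
    (ho : Sub n (fc Y)) : s ∊ fc Y := by
  refine fc_of_isFin (hs.1.isFin hn) fun p hp => ?_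
  obtain ⟨i, hi, rfl⟩ := hs.1.mem_iff.1 hp
  exact pair_mem_fc (ho i hi) (hX _ (hs.2 i _ (hs.1.pairIn_iff.2 ⟨hi, rfl⟩)))

/-! ### Sequences of elements of a set -/

theorem IsSeq.app_mem {X n s i : M} (h : IsSeq X n s) (hi : i ∊ n) : app s i ∊ X :=
  h.2 i _ (h.1.pairIn_iff.2 ⟨hi, rfl⟩)

theorem IsFun.isSeq {X n s : M} (h : IsFun s n) (h' : ∀ i, i ∊ n → app s i ∊ X) : IsSeq X n s :=
  ⟨h, fun i x hix => by
    obtain ⟨hi, rfl⟩ := h.pairIn_iff.1 hix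
    exact h' i hi⟩

theorem isSeq_emp {X : M} : IsSeq X (emp M) (emp M) := isFun_emp.isSeq (by simp)

theorem IsSeq.snoc {X n s x : M} (h : IsSeq X n s) (hx : x ∊ X) : IsSeq X (succ n) (ext s n x) :=
  (h.1.snoc x).isSeq fun i hi => by
    rcases mem_succ.1 hi with hi | rfl
    · rw [h.1.app_ext_of_mem hi]; exact h.app_mem hi
    · rwa [h.1.app_ext_self]

theorem IsSeq.exists_eq_ext {X n s : M} (h : IsSeq X (succ n) s) :
    ∃ t x, IsSeq X n t ∧ x ∊ X ∧ s = ext t n x := by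
  obtain ⟨t, x, ht, rfl⟩ := h.1.exists_eq_ext
  refine ⟨t, x, ht.isSeq fun i hi => ?_, ?_, rfl⟩
  · rw [← ht.app_ext_of_mem hi (x := x)]
    exact h.app_mem (mem_succ.2 (.inl hi))
  · rw [← ht.app_ext_self (x := x)]
    exact h.app_mem (mem_succ.2 (.inr rfl))

theorem IsSeq.mono {X Y n s : M} (h : IsSeq X n s) (hXY : Sub X Y) : IsSeq Y n s :=
  ⟨h.1, fun i x hx => hXY x (h.2 i x hx)⟩

/-- A definable functional relation between two sets is a function. -/
theorem exists_seq (F : M → M → Prop) [hF : Dfb (fun w : Fin 2 → M => F (w 0) (w 1))] {X n : M}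
    (h : ∀ i, i ∊ n → ∃ x, x ∊ X ∧ F i x) (h' : ∀ i x y, i ∊ n → F i x → F i y → x = y) :
    ∃ s, IsSeq X n s ∧ ∀ i, i ∊ n → F i (app s i) := by
  have (m : ℕ) (a b : (Fin m → M) → M) [DTm a] [DTm b] : Dfb (fun w => F (a w) (b w)) :=
    hF.subst2 a b
  let s := sep (fun p => ∃ i x, i ∊ n ∧ x ∊ X ∧ F i x ∧ p = pair i x) (fc (un n X))
  have hs : ∀ i x, PairIn s i x ↔ i ∊ n ∧ x ∊ X ∧ F i x := fun i x => by
    rw [pairIn_iff]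
    simp only [s, mem_sep, pair_inj]
    constructor
    · rintro ⟨-, i, x, h1, h2, h3, rfl, rfl⟩
      exact ⟨h1, h2, h3⟩
    · rintro ⟨h1, h2, h3⟩
      exact ⟨pair_mem_fc (mem_fc (by simp [h1])) (mem_fc (by simp [h2])),
        i, x, h1, h2, h3, rfl, rfl⟩
  have hf : IsFun s n := by
    refine ⟨fun p hp => ?_, fun i => ?_, fun i y z hy hz => ?_⟩
    · obtain ⟨-, i, x, -, -, -, rfl⟩ := mem_sep.1 hp
      exact ⟨i, x, isPair_iff.2 rfl⟩
    · simp only [hs]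
      exact ⟨fun hi => (h i hi).imp fun x hx => ⟨hi, hx⟩, fun ⟨x, hx⟩ => hx.1⟩
    · rw [hs] at hy hz
      exact h' i y z hy.1 hy.2.2 hz.2.2
  refine ⟨s, ⟨hf, fun i x hx => ((hs i x).1 hx).2.1⟩, fun i hi => ?_⟩
  exact ((hs _ _).1 (hf.pairIn_iff.2 ⟨hi, rfl⟩)).2.2

theorem exists_seq_of_term (t : M → M) [ht : DTm (fun w : Fin 1 → M => t (w 0))] {X n : M}
    (h : ∀ i, i ∊ n → t i ∊ X) : ∃ s, IsSeq X n s ∧ ∀ i, i ∊ n → app s i = t i := by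
  have : Dfb (fun w : Fin 2 → M => w 1 = t (w 0)) := ht.out
  obtain ⟨s, hs, hs'⟩ := exists_seq (fun i x => x = t i) (X := X) (n := n)
    (fun i hi => ⟨t i, h i hi, rfl⟩) (fun i x y _ h1 h2 => h1.trans h2.symm)
  exact ⟨s, hs, hs'⟩

/-! ### Formulas of the model -/

/-- The code of `v_i ∈ v_j`. -/
noncomputable def memC (i j : M) : M := pair (num M 0) (pair i j)
/-- The code of `v_i = v_j`. -/
noncomputable def eqC (i j : M) : M := pair (num M 1) (pair i j)
/-- The code of `¬ ψ`. -/
noncomputable def negC (ψ : M) : M := pair (num M 2) ψ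
/-- The code of `ψ ∧ χ`. -/
noncomputable def andC (ψ χ : M) : M := pair (num M 3) (pair ψ χ)
/-- The code of the existential quantification of `ψ`. -/
noncomputable def exC (ψ : M) : M := pair (num M 4) ψ

theorem isMemCode_iff {φ i j : M} : IsMemCode φ i j ↔ φ = memC i j := by
  simp [IsMemCode, isNumeral_iff, isTriple_iff, memC]
theorem isEqCode_iff {φ i j : M} : IsEqCode φ i j ↔ φ = eqC i j := by
  simp [IsEqCode, isNumeral_iff, isTriple_iff, eqC]
theorem isNegCode_iff {φ ψ : M} : IsNegCode φ ψ ↔ φ = negC ψ := by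
  simp [IsNegCode, isNumeral_iff, isPair_iff, negC]
theorem isAndCode_iff {φ ψ χ : M} : IsAndCode φ ψ χ ↔ φ = andC ψ χ := by
  simp [IsAndCode, isNumeral_iff, isTriple_iff, andC]
theorem isExCode_iff {φ ψ : M} : IsExCode φ ψ ↔ φ = exC ψ := by
  simp [IsExCode, isNumeral_iff, isPair_iff, exC]

section

variable {n : ℕ} (a b : (Fin n → M) → M) [DTm a] [DTm b]

instance : DTm (fun w => memC (a w) (b w)) := DTm.mk2 (by unfold memC; infer_instance) a b
instance : DTm (fun w => eqC (a w) (b w)) := DTm.mk2 (by unfold eqC; infer_instance) a b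
instance : DTm (fun w => negC (a w)) := DTm.mk1 (by unfold negC; infer_instance) a
instance : DTm (fun w => andC (a w) (b w)) := DTm.mk2 (by unfold andC; infer_instance) a b
instance : DTm (fun w => exC (a w)) := DTm.mk1 (by unfold exC; infer_instance) a

end

theorem isFormClosed_iff {F : M} : IsFormClosed F ↔
    (∀ n i j, IsNat n → i ∊ n → j ∊ n → pair n (memC i j) ∊ F ∧ pair n (eqC i j) ∊ F) ∧
    (∀ n ψ, pair n ψ ∊ F → pair n (negC ψ) ∊ F) ∧
    (∀ n ψ χ, pair n ψ ∊ F → pair n χ ∊ F → pair n (andC ψ χ) ∊ F) ∧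
    (∀ n ψ, pair (succ n) ψ ∊ F → pair n (exC ψ) ∊ F) := by
  simp only [IsFormClosed, isMemCode_iff, isEqCode_iff, isNegCode_iff, isAndCode_iff, isExCode_iff,
    isSucc_iff, pairIn_iff]
  refine and_congr ⟨fun h n i j hn hi hj => ⟨h n i j _ hn hi hj (.inl rfl),
    h n i j _ hn hi hj (.inr rfl)⟩, ?_⟩ (and_congr ?_ (and_congr ?_ ?_))
  · rintro h n i j φ hn hi hj (rfl | rfl)
    exacts [(h n i j hn hi hj).1, (h n i j hn hi hj).2]
  · exact ⟨fun h n ψ hψ => h n _ ψ hψ rfl, by rintro h n φ ψ hψ rfl; exact h n ψ hψ⟩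
  · exact ⟨fun h n ψ χ hψ hχ => h n _ ψ χ hψ hχ rfl,
      by rintro h n φ ψ χ hψ hχ rfl; exact h n ψ χ hψ hχ⟩
  · exact ⟨fun h n ψ hψ => h n _ _ ψ rfl hψ rfl,
      by rintro h n n' φ ψ rfl hψ rfl; exact h n ψ hψ⟩

theorem num_mem_fc {X : M} (h : Sub (omega M) (fc X)) (k : ℕ) : num M k ∊ fc X :=
  h _ (mem_omega.2 (isNat_num k))

variable (M) in
/-- A set of pairs closed under the formation rules for formulas. -/
theorem exists_isFormClosed :
    ∃ F : M, IsFormClosed F ∧ ∀ p, p ∊ F → ∃ n φ, p = pair n φ ∧ IsNat n ∧ φ ∊ fc (omega M) := by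
  refine ⟨sep (fun p => ∃ n φ, p = pair n φ ∧ IsNat n ∧ φ ∊ fc (omega M)) (fc (omega M)), ?_,
    fun p hp => (mem_sep.1 hp).2⟩
  have ho : Sub (omega M) (fc (omega M)) := fun x hx => mem_fc hx
  have key : ∀ n φ : M, pair n φ ∊ sep (fun p => ∃ n φ, p = pair n φ ∧ IsNat n ∧ φ ∊ fc (omega M))
      (fc (omega M)) ↔ IsNat n ∧ φ ∊ fc (omega M) := fun n φ => by
    simp only [mem_sep, pair_inj]
    constructor
    · rintro ⟨-, n, φ, ⟨rfl, rfl⟩, h1, h2⟩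
      exact ⟨h1, h2⟩
    · rintro ⟨h1, h2⟩
      exact ⟨pair_mem_fc (ho _ (mem_omega.2 h1)) h2, n, φ, ⟨rfl, rfl⟩, h1, h2⟩
  simp only [isFormClosed_iff, key]
  refine ⟨fun n i j hn hi hj => ?_, fun n ψ h => ?_, fun n ψ χ h1 h2 => ?_, fun n ψ h => ?_⟩
  · have hi' := ho _ (mem_omega.2 (hn.mem hi))
    have hj' := ho _ (mem_omega.2 (hn.mem hj))
    exact ⟨⟨hn, pair_mem_fc (num_mem_fc ho _) (pair_mem_fc hi' hj')⟩,
      ⟨hn, pair_mem_fc (num_mem_fc ho _) (pair_mem_fc hi' hj')⟩⟩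
  · exact ⟨h.1, pair_mem_fc (num_mem_fc ho _) h.2⟩
  · exact ⟨h1.1, pair_mem_fc (num_mem_fc ho _) (pair_mem_fc h1.2 h2.2)⟩
  · exact ⟨h.1.mem (mem_succ.2 (.inr rfl)), pair_mem_fc (num_mem_fc ho _) h.2⟩

variable (M) in
/-- The set of pairs `⟨n, φ⟩` with `φ` a formula in the context `n`. -/
noncomputable def forms : M :=
  sep (fun p => ∃ n φ, p = pair n φ ∧ IsForm n φ) (exists_isFormClosed M).choose

theorem pair_mem_forms {n φ : M} : pair n φ ∊ forms M ↔ IsForm n φ := by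
  simp only [forms, mem_sep, pair_inj]
  constructor
  · rintro ⟨-, n, φ, ⟨rfl, rfl⟩, h⟩
    exact h
  · exact fun h => ⟨pairIn_iff.1 (h _ (exists_isFormClosed M).choose_spec.1), n, φ, ⟨rfl, rfl⟩, h⟩

theorem IsForm.mem_fc {n φ : M} (h : IsForm n φ) : φ ∊ fc (omega M) := by
  obtain ⟨F, hF, hF'⟩ := exists_isFormClosed M
  obtain ⟨n, φ, he, -, h2⟩ := hF' _ (pairIn_iff.1 (h F hF))
  obtain ⟨rfl, rfl⟩ := pair_inj.1 he
  exact h2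

theorem isForm_memC {n i j : M} (hn : IsNat n) (hi : i ∊ n) (hj : j ∊ n) : IsForm n (memC i j) :=
  fun _ hF => pairIn_iff.2 ((isFormClosed_iff.1 hF).1 n i j hn hi hj).1

theorem isForm_eqC {n i j : M} (hn : IsNat n) (hi : i ∊ n) (hj : j ∊ n) : IsForm n (eqC i j) :=
  fun _ hF => pairIn_iff.2 ((isFormClosed_iff.1 hF).1 n i j hn hi hj).2

theorem IsForm.negC {n φ : M} (h : IsForm n φ) : IsForm n (negC φ) :=
  fun F hF => pairIn_iff.2 ((isFormClosed_iff.1 hF).2.1 n φ (pairIn_iff.1 (h F hF)))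

theorem IsForm.andC {n φ ψ : M} (h : IsForm n φ) (h' : IsForm n ψ) : IsForm n (andC φ ψ) :=
  fun F hF => pairIn_iff.2 ((isFormClosed_iff.1 hF).2.2.1 n φ ψ (pairIn_iff.1 (h F hF))
    (pairIn_iff.1 (h' F hF)))

theorem IsForm.exC {n φ : M} (h : IsForm (succ n) φ) : IsForm n (exC φ) :=
  fun F hF => pairIn_iff.2 ((isFormClosed_iff.1 hF).2.2.2 n φ (pairIn_iff.1 (h F hF)))

/-- Induction on the construction of formulas, for definable properties. -/
theorem form_induction (P : M → M → Prop) [hP : Dfb (fun w : Fin 2 → M => P (w 0) (w 1))]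
    (hmem : ∀ n i j, IsNat n → i ∊ n → j ∊ n → P n (memC i j))
    (heq : ∀ n i j, IsNat n → i ∊ n → j ∊ n → P n (eqC i j))
    (hneg : ∀ n φ, IsForm n φ → P n φ → P n (negC φ))
    (hand : ∀ n φ ψ, IsForm n φ → IsForm n ψ → P n φ → P n ψ → P n (andC φ ψ))
    (hex : ∀ n φ, IsForm (succ n) φ → P (succ n) φ → P n (exC φ))
    (n φ : M) (h : IsForm n φ) : P n φ := by
  have (m : ℕ) (a b : (Fin m → M) → M) [DTm a] [DTm b] : Dfb (fun w => P (a w) (b w)) :=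
    hP.subst2 a b
  obtain ⟨F, hF⟩ := exists_sep (fun p : M => ∃ n φ : M, p = pair n φ ∧ P n φ) (forms M)
  have key : ∀ n φ : M, pair n φ ∊ F ↔ IsForm n φ ∧ P n φ := fun n φ => by
    simp only [hF, pair_inj, pair_mem_forms]
    constructor
    · rintro ⟨h, n, φ, ⟨rfl, rfl⟩, h'⟩
      exact ⟨h, h'⟩
    · exact fun h => ⟨h.1, n, φ, ⟨rfl, rfl⟩, h.2⟩
  have hF : IsFormClosed F := by
    simp only [isFormClosed_iff, key]
    exact ⟨fun n i j hn hi hj => ⟨⟨isForm_memC hn hi hj, hmem n i j hn hi hj⟩,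
      ⟨isForm_eqC hn hi hj, heq n i j hn hi hj⟩⟩, fun n ψ h => ⟨h.1.negC, hneg n ψ h.1 h.2⟩,
      fun n ψ χ h1 h2 => ⟨h1.1.andC h2.1, hand n ψ χ h1.1 h2.1 h1.2 h2.2⟩,
      fun n ψ h => ⟨h.1.exC, hex n ψ h.1 h.2⟩⟩
  exact ((key n φ).1 (pairIn_iff.1 (h _ hF))).2

/-- Unique readability: the immediate subformulas of a formula are formulas. -/
theorem IsForm.inversion {n φ : M} (h : IsForm n φ) : IsNat n ∧
    (∀ i j, φ = PowerlessSet.memC i j → i ∊ n ∧ j ∊ n) ∧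
    (∀ i j, φ = PowerlessSet.eqC i j → i ∊ n ∧ j ∊ n) ∧
    (∀ ψ, φ = PowerlessSet.negC ψ → IsForm n ψ) ∧
    (∀ ψ χ, φ = PowerlessSet.andC ψ χ → IsForm n ψ ∧ IsForm n χ) ∧
    (∀ ψ, φ = PowerlessSet.exC ψ → IsForm (succ n) ψ) := by
  refine form_induction (fun n φ => IsNat n ∧
    (∀ i j, φ = PowerlessSet.memC i j → i ∊ n ∧ j ∊ n) ∧
    (∀ i j, φ = PowerlessSet.eqC i j → i ∊ n ∧ j ∊ n) ∧
    (∀ ψ, φ = PowerlessSet.negC ψ → IsForm n ψ) ∧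
    (∀ ψ χ, φ = PowerlessSet.andC ψ χ → IsForm n ψ ∧ IsForm n χ) ∧
    (∀ ψ, φ = PowerlessSet.exC ψ → IsForm (succ n) ψ)) ?_ ?_ ?_ ?_ ?_ n φ h
  · intro n i j hn hi hj
    simp +contextual [PowerlessSet.memC, PowerlessSet.eqC, PowerlessSet.negC, PowerlessSet.andC,
      PowerlessSet.exC, hn, hi, hj]
  · intro n i j hn hi hj
    simp +contextual [PowerlessSet.memC, PowerlessSet.eqC, PowerlessSet.negC, PowerlessSet.andC,
      PowerlessSet.exC, hn, hi, hj]
  · intro n φ hφ ih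
    simp [PowerlessSet.memC, PowerlessSet.eqC, PowerlessSet.negC, PowerlessSet.andC,
      PowerlessSet.exC, ih.1, hφ]
  · intro n φ ψ hφ hψ ih1 ih2
    simp [PowerlessSet.memC, PowerlessSet.eqC, PowerlessSet.negC, PowerlessSet.andC,
      PowerlessSet.exC, ih1.1]
    exact ⟨hφ, hψ⟩
  · intro n φ hφ ih
    simp [PowerlessSet.memC, PowerlessSet.eqC, PowerlessSet.negC, PowerlessSet.andC,
      PowerlessSet.exC, hφ]
    exact ih.1.mem (mem_succ.2 (.inr rfl))

theorem IsForm.isNat {n φ : M} (h : IsForm n φ) : IsNat n := h.inversion.1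

/-! ### Existence and uniqueness of truth sets -/

/-- `ψ` in the context `m` is an immediate subformula of `φ` in the context `n`. -/
def Imm (n φ m ψ : M) : Prop :=
  (m = n ∧ φ = negC ψ) ∨ (m = n ∧ ∃ χ, φ = andC ψ χ ∨ φ = andC χ ψ) ∨ (m = succ n ∧ φ = exC ψ)

/-- The right-hand sides of Tarski's conditions: the formula `φ` should be true of the sequence `s`,
given the truth values assigned by `τ` to its immediate subformulas. -/
def TCond (X τ n φ s : M) : Prop :=
  (∃ i j, φ = memC i j ∧ ∃ x y, PairIn s i x ∧ PairIn s j y ∧ x ∊ y) ∨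
  (∃ i j, φ = eqC i j ∧ ∃ x y, PairIn s i x ∧ PairIn s j y ∧ x = y) ∨
  (∃ ψ, φ = negC ψ ∧ ¬ TrueBy τ n ψ s) ∨
  (∃ ψ χ, φ = andC ψ χ ∧ TrueBy τ n ψ s ∧ TrueBy τ n χ s) ∨
  (∃ ψ, φ = exC ψ ∧ ∃ x, x ∊ X ∧ TrueBy τ (succ n) ψ (ext s n x))

section

variable {n : ℕ} (a b c d : (Fin n → M) → M) [DTm a] [DTm b] [DTm c] [DTm d]

set_option synthInstance.maxHeartbeats 200000
set_option synthInstance.maxSize 1000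

instance (X : M) : Dfb (fun w => TCond X (a w) (b w) (c w) (d w)) :=
  Dfb.subst4 (R := TCond X) (by unfold TCond; infer_instance) a b c d

end

theorem trueBy_iff {τ n φ s : M} : TrueBy τ n φ s ↔ pair n (pair φ s) ∊ τ := by
  simp [TrueBy, isTriple_iff]

theorem tcond_memC {X τ n i j s : M} :
    TCond X τ n (memC i j) s ↔ ∃ x y, PairIn s i x ∧ PairIn s j y ∧ x ∊ y := by
  simp [TCond, memC, eqC, negC, andC, exC]

theorem tcond_eqC {X τ n i j s : M} :
    TCond X τ n (eqC i j) s ↔ ∃ x y, PairIn s i x ∧ PairIn s j y ∧ x = y := by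
  simp only [TCond, memC, eqC, negC, andC, exC, pair_inj, num_inj]
  simp

theorem tcond_negC {X τ n ψ s : M} : TCond X τ n (negC ψ) s ↔ ¬ TrueBy τ n ψ s := by
  simp [TCond, memC, eqC, negC, andC, exC]

theorem tcond_andC {X τ n ψ χ s : M} :
    TCond X τ n (andC ψ χ) s ↔ TrueBy τ n ψ s ∧ TrueBy τ n χ s := by
  simp [TCond, memC, eqC, negC, andC, exC]

theorem tcond_exC {X τ n ψ s : M} :
    TCond X τ n (exC ψ) s ↔ ∃ x, x ∊ X ∧ TrueBy τ (succ n) ψ (ext s n x) := by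
  simp [TCond, memC, eqC, negC, andC, exC]

theorem tcond_congr {X τ τ' n φ s : M} (hs : IsSeq X n s)
    (h : ∀ m ψ, Imm n φ m ψ → ∀ s, IsSeq X m s → (TrueBy τ m ψ s ↔ TrueBy τ' m ψ s)) :
    TCond X τ n φ s ↔ TCond X τ' n φ s := by
  unfold TCond
  refine or_congr Iff.rfl (or_congr Iff.rfl (or_congr ?_ (or_congr ?_ ?_)))
  · refine exists_congr fun ψ => and_congr_right fun e => not_congr ?_
    exact h n ψ (.inl ⟨rfl, e⟩) s hs
  · refine exists_congr fun ψ => exists_congr fun χ => and_congr_right fun e => and_congr ?_ ?_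
    · exact h n ψ (.inr (.inl ⟨rfl, χ, .inl e⟩)) s hs
    · exact h n χ (.inr (.inl ⟨rfl, ψ, .inr e⟩)) s hs
  · refine exists_congr fun ψ => and_congr_right fun e => exists_congr fun x =>
      and_congr_right fun hx => ?_
    exact h _ ψ (.inr (.inr ⟨rfl, e⟩)) _ (hs.snoc hx)

theorem IsForm.imm {n φ m ψ : M} (h : IsForm n φ) (hi : Imm n φ m ψ) : IsForm m ψ := by
  obtain ⟨-, -, -, h1, h2, h3⟩ := h.inversion
  rcases hi with ⟨rfl, e⟩ | ⟨rfl, χ, e | e⟩ | ⟨rfl, e⟩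
  exacts [h1 _ e, (h2 _ _ e).1, (h2 _ _ e).2, h3 _ e]

theorem isSubformulaClosed_iff {D : M} : IsSubformulaClosed D ↔
    ∀ n φ m ψ, PairIn D n φ → Imm n φ m ψ → PairIn D m ψ := by
  simp only [IsSubformulaClosed, isNegCode_iff, isAndCode_iff, isExCode_iff, isSucc_iff]
  constructor
  · rintro ⟨h1, h2, h3⟩ n φ m ψ h (⟨rfl, e⟩ | ⟨rfl, χ, e | e⟩ | ⟨rfl, e⟩)
    exacts [h1 _ _ _ h e, (h2 _ _ _ _ h e).1, (h2 _ _ _ _ h e).2, h3 _ _ _ _ h e rfl]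
  · intro h
    refine ⟨fun n φ ψ hD e => h _ _ _ _ hD (.inl ⟨rfl, e⟩), fun n φ ψ χ hD e =>
      ⟨h _ _ _ _ hD (.inr (.inl ⟨rfl, _, .inl e⟩)), h _ _ _ _ hD (.inr (.inl ⟨rfl, _, .inr e⟩))⟩,
      fun n n' φ ψ hD e e' => h _ _ _ _ hD (.inr (.inr ⟨e', e⟩))⟩

/-- Every formula has one of the five shapes. -/
theorem IsForm.shape {n φ : M} (h : IsForm n φ) : (∃ i j, φ = PowerlessSet.memC i j) ∨
    (∃ i j, φ = PowerlessSet.eqC i j) ∨ (∃ ψ, φ = PowerlessSet.negC ψ) ∨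
    (∃ ψ χ, φ = PowerlessSet.andC ψ χ) ∨ ∃ ψ, φ = PowerlessSet.exC ψ := by
  refine form_induction (fun _ φ => (∃ i j, φ = PowerlessSet.memC i j) ∨
    (∃ i j, φ = PowerlessSet.eqC i j) ∨ (∃ ψ, φ = PowerlessSet.negC ψ) ∨
    (∃ ψ χ, φ = PowerlessSet.andC ψ χ) ∨ ∃ ψ, φ = PowerlessSet.exC ψ) ?_ ?_ ?_ ?_ ?_ n φ h
  · exact fun _ i j _ _ _ => .inl ⟨i, j, rfl⟩
  · exact fun _ i j _ _ _ => .inr (.inl ⟨i, j, rfl⟩)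
  · exact fun _ ψ _ _ => .inr (.inr (.inl ⟨ψ, rfl⟩))
  · exact fun _ ψ χ _ _ _ _ => .inr (.inr (.inr (.inl ⟨ψ, χ, rfl⟩)))
  · exact fun _ ψ _ _ => .inr (.inr (.inr (.inr ⟨ψ, rfl⟩)))

theorem isTruthSet_iff {X D τ : M} (hD : ∀ m ψ, PairIn D m ψ → IsForm m ψ) :
    IsTruthSet X D τ ↔
      ∀ n φ s, PairIn D n φ → IsSeq X n s → (TrueBy τ n φ s ↔ TCond X τ n φ s) := by
  simp only [IsTruthSet, isMemCode_iff, isEqCode_iff, isNegCode_iff, isAndCode_iff, isExCode_iff,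
    isSucc_iff, isExt_iff]
  constructor
  · rintro ⟨h1, h2, h3, h4, h5⟩ n φ s hφ hs
    rcases (hD n φ hφ).shape with ⟨i, j, rfl⟩ | ⟨i, j, rfl⟩ | ⟨ψ, rfl⟩ | ⟨ψ, χ, rfl⟩ | ⟨ψ, rfl⟩
    · rw [tcond_memC]; exact h1 _ _ _ _ _ hφ hs rfl
    · rw [tcond_eqC]; exact h2 _ _ _ _ _ hφ hs rfl
    · rw [tcond_negC]; exact h3 _ _ _ _ hφ hs rfl
    · rw [tcond_andC]; exact h4 _ _ _ _ _ hφ hs rfl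
    · rw [tcond_exC, h5 _ _ _ _ _ hφ hs rfl rfl]
      exact exists_congr fun x => ⟨by rintro ⟨_, h, rfl, h'⟩; exact ⟨h, h'⟩,
        fun h => ⟨_, h.1, rfl, h.2⟩⟩
  · intro h
    refine ⟨?_, ?_, ?_, ?_, ?_⟩
    · rintro n _ s i j hφ hs rfl
      rw [h _ _ _ hφ hs, tcond_memC]
    · rintro n _ s i j hφ hs rfl
      rw [h _ _ _ hφ hs, tcond_eqC]
    · rintro n _ s ψ hφ hs rfl
      rw [h _ _ _ hφ hs, tcond_negC]
    · rintro n _ s ψ χ hφ hs rfl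
      rw [h _ _ _ hφ hs, tcond_andC]
    · rintro n _ _ s ψ hφ hs rfl rfl
      rw [h _ _ _ hφ hs, tcond_exC]
      exact exists_congr fun x => ⟨fun h => ⟨_, h.1, rfl, h.2⟩,
        by rintro ⟨_, h, rfl, h'⟩; exact ⟨h, h'⟩⟩

/-- A uniform form of induction on formulas, in terms of immediate subformulas. -/
theorem imm_induction (P : M → M → Prop) [hP : Dfb (fun w : Fin 2 → M => P (w 0) (w 1))]
    (h : ∀ n φ, IsForm n φ → (∀ m ψ, Imm n φ m ψ → P m ψ) → P n φ)
    (n φ : M) (hφ : IsForm n φ) : P n φ := by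
  refine form_induction P ?_ ?_ ?_ ?_ ?_ n φ hφ
  · intro n i j hn hi hj
    refine h _ _ (isForm_memC hn hi hj) fun m ψ hm => ?_
    simp [Imm, memC, negC, andC, exC] at hm
  · intro n i j hn hi hj
    refine h _ _ (isForm_eqC hn hi hj) fun m ψ hm => ?_
    simp [Imm, eqC, negC, andC, exC] at hm
  · intro n φ hφ ih
    refine h _ _ hφ.negC fun m ψ hm => ?_
    simp [Imm, negC, andC, exC] at hm
    obtain ⟨rfl, rfl⟩ := hm
    exact ih
  · intro n φ φ' hφ hφ' ih ih'
    refine h _ _ (hφ.andC hφ') fun m ψ hm => ?_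
    simp [Imm, negC, andC, exC] at hm
    obtain ⟨rfl, χ, ⟨rfl, rfl⟩ | ⟨rfl, rfl⟩⟩ := hm
    exacts [ih, ih']
  · intro n φ hφ ih
    refine h _ _ hφ.exC fun m ψ hm => ?_
    simp [Imm, negC, andC, exC] at hm
    obtain ⟨rfl, rfl⟩ := hm
    exact ih

/-- `τ` is a truth set over `X` for the subformula-closed set `D` of formulas. -/
def Evaluates (X D τ : M) : Prop :=
  (∀ m ψ, PairIn D m ψ → IsForm m ψ) ∧ IsSubformulaClosed D ∧ IsTruthSet X D τ

instance {n : ℕ} (a b c : (Fin n → M) → M) [DTm a] [DTm b] [DTm c] :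
    Dfb (fun w => Evaluates (a w) (b w) (c w)) :=
  Dfb.subst3 (by unfold Evaluates; infer_instance) a b c

theorem sat_iff {X n φ s : M} :
    Sat X n φ s ↔ ∃ D τ, Evaluates X D τ ∧ PairIn D n φ ∧ TrueBy τ n φ s := by
  unfold Sat Evaluates
  refine exists_congr fun D => exists_congr fun τ => ?_
  tauto

theorem Evaluates.trueBy {X D τ n φ s : M} (h : Evaluates X D τ) (hφ : PairIn D n φ)
    (hs : IsSeq X n s) : TrueBy τ n φ s ↔ TCond X τ n φ s :=
  (isTruthSet_iff h.1).1 h.2.2 n φ s hφ hs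

theorem Evaluates.imm {X D τ n φ m ψ : M} (h : Evaluates X D τ) (hφ : PairIn D n φ)
    (hi : Imm n φ m ψ) : PairIn D m ψ := isSubformulaClosed_iff.1 h.2.1 _ _ _ _ hφ hi

set_option synthInstance.maxHeartbeats 200000 in
/-- Two truth sets over `X` agree on the formulas that both of them evaluate. -/
theorem Evaluates.unique {X D τ D' τ' n φ s : M} (h : Evaluates X D τ) (h' : Evaluates X D' τ')
    (hφ : PairIn D n φ) (hφ' : PairIn D' n φ) (hs : IsSeq X n s) :
    TrueBy τ n φ s ↔ TrueBy τ' n φ s := by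
  refine imm_induction (fun n φ => PairIn D n φ → PairIn D' n φ → ∀ s, IsSeq X n s →
    (TrueBy τ n φ s ↔ TrueBy τ' n φ s)) ?_ n φ (h.1 _ _ hφ) hφ hφ' s hs
  intro n φ _ ih hφ hφ' s hs
  rw [h.trueBy hφ hs, h'.trueBy hφ' hs]
  exact tcond_congr hs fun m ψ hi s hs => ih m ψ hi (h.imm hφ hi) (h'.imm hφ' hi) s hs

/-- A set containing all `⟨n, ⟨φ, s⟩⟩`, where `φ` is a formula in the context `n` and `s` a sequence
of elements of `X` of length `n`. -/
noncomputable def codes (X : M) : M := fc (un (fc (omega M)) X)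

theorem nat_mem_codes {X n : M} (hn : IsNat n) : n ∊ codes X :=
  mem_fc (mem_un.2 (.inl (mem_fc (mem_omega.2 hn))))

theorem IsForm.mem_codes {X n φ : M} (h : IsForm n φ) : φ ∊ codes X :=
  PowerlessSet.mem_fc (mem_un.2 (.inl h.mem_fc))

theorem IsSeq.mem_codes {X n s : M} (hn : IsNat n) (h : IsSeq X n s) : s ∊ codes X :=
  h.mem_fc hn (fun _ hx => PowerlessSet.mem_fc (mem_un.2 (.inr hx)))
    fun _ hi => nat_mem_codes (hn.mem hi)

/-- There is a set deciding truth as prescribed by any definable `C`. -/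
theorem exists_truth (X : M) (C : M → M → M → Prop)
    [hC : Dfb (fun w : Fin 3 → M => C (w 0) (w 1) (w 2))] :
    ∃ τ, ∀ n φ s, IsForm n φ → IsSeq X n s → (TrueBy τ n φ s ↔ C n φ s) := by
  have (m : ℕ) (a b c : (Fin m → M) → M) [DTm a] [DTm b] [DTm c] :
      Dfb (fun w => C (a w) (b w) (c w)) := hC.subst3 a b c
  obtain ⟨τ, hτ⟩ := exists_sep (fun p : M => ∃ n φ s : M, p = pair n (pair φ s) ∧ C n φ s)
    (codes X)
  refine ⟨τ, fun n φ s hφ hs => ?_⟩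
  rw [trueBy_iff, hτ]
  constructor
  · rintro ⟨-, n', φ', s', e, h⟩
    simp only [pair_inj] at e
    obtain ⟨rfl, rfl, rfl⟩ := e
    exact h
  · exact fun h => ⟨pair_mem_fc (nat_mem_codes hφ.isNat)
      (pair_mem_fc hφ.mem_codes (hs.mem_codes hφ.isNat)), n, φ, s, rfl, h⟩

set_option synthInstance.maxHeartbeats 200000 in
/-- Every formula can be evaluated over `X`.  The set of evaluable formulas is closed under
immediate subformulas and is itself evaluated by some truth set, and a formula whose
immediate subformulas belong to it can be added to it. -/
theorem exists_evaluates (X : M) {n φ : M} (hφ : IsForm n φ) :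
    ∃ D τ, Evaluates X D τ ∧ PairIn D n φ := by
  let E : M → M → Prop := fun n φ => ∃ D τ, Evaluates X D τ ∧ PairIn D n φ
  have hE (m : ℕ) (a b : (Fin m → M) → M) [DTm a] [DTm b] : Dfb (fun w => E (a w) (b w)) :=
    Dfb.subst2 (by unfold E; infer_instance) a b
  obtain ⟨D, hD'⟩ := exists_sep (fun p : M => ∃ n φ : M, p = pair n φ ∧ E n φ) (forms M)
  have hD : ∀ n φ : M, PairIn D n φ ↔ IsForm n φ ∧ E n φ := fun n φ => by
    rw [pairIn_iff, hD', pair_mem_forms]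
    simp only [pair_inj]
    refine and_congr_right fun _ => ⟨?_, fun h => ⟨_, _, ⟨rfl, rfl⟩, h⟩⟩
    rintro ⟨_, _, ⟨rfl, rfl⟩, h⟩
    exact h
  obtain ⟨τ, hτ⟩ := exists_truth X (fun n φ s => Sat X n φ s)
  have hDi : ∀ n φ m ψ : M, PairIn D n φ → Imm n φ m ψ → PairIn D m ψ := fun n φ m ψ h hi => by
    rw [hD] at h ⊢
    obtain ⟨hf, D', τ', h1, h2⟩ := h
    exact ⟨hf.imm hi, D', τ', h1, h1.imm h2 hi⟩
  have agree : ∀ D' τ', Evaluates X D' τ' → ∀ n φ s, PairIn D' n φ → IsSeq X n s →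
      (TrueBy τ n φ s ↔ TrueBy τ' n φ s) := fun D' τ' h' n φ s hφ hs => by
    rw [hτ n φ s (h'.1 _ _ hφ) hs, sat_iff]
    exact ⟨fun ⟨D'', τ'', h1, h2, h3⟩ => (h1.unique h' h2 hφ hs).1 h3, fun h => ⟨D', τ', h', hφ, h⟩⟩
  have hev : ∀ n φ s, PairIn D n φ → IsSeq X n s → (TrueBy τ n φ s ↔ TCond X τ n φ s) := by
    intro n φ s hφ hs
    obtain ⟨-, D', τ', h', hφ'⟩ := (hD _ _).1 hφ
    rw [agree D' τ' h' n φ s hφ' hs, h'.trueBy hφ' hs]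
    exact tcond_congr hs fun m ψ hi s hs => (agree D' τ' h' m ψ s (h'.imm hφ' hi) hs).symm
  refine imm_induction E ?_ n φ hφ
  intro n φ hφ ih
  obtain ⟨τ', hτ'⟩ := exists_truth X (fun n φ s => TCond X τ n φ s)
  have hP : ∀ m ψ, PairIn (un D (upair (pair n φ) (pair n φ))) m ψ ↔
      PairIn D m ψ ∨ (m = n ∧ ψ = φ) := fun m ψ => by simp [pairIn_iff]
  have hform : ∀ m ψ, PairIn (un D (upair (pair n φ) (pair n φ))) m ψ → IsForm m ψ := by
    intro m ψ h
    rcases (hP _ _).1 h with h | ⟨rfl, rfl⟩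
    exacts [((hD _ _).1 h).1, hφ]
  have hsub : ∀ m ψ m' ψ', PairIn (un D (upair (pair n φ) (pair n φ))) m ψ → Imm m ψ m' ψ' →
      PairIn D m' ψ' := by
    intro m ψ m' ψ' h hi
    rcases (hP _ _).1 h with h | ⟨rfl, rfl⟩
    · exact hDi _ _ _ _ h hi
    · exact (hD _ _).2 ⟨hφ.imm hi, ih _ _ hi⟩
  refine ⟨un D (upair (pair n φ) (pair n φ)), τ', ⟨hform, ?_, ?_⟩, (hP _ _).2 (.inr ⟨rfl, rfl⟩)⟩
  · exact isSubformulaClosed_iff.2 fun m ψ m' ψ' h hi => (hP _ _).2 (.inl (hsub _ _ _ _ h hi))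
  · refine (isTruthSet_iff hform).2 fun m ψ s h hs => ?_
    rw [hτ' m ψ s (hform _ _ h) hs]
    refine tcond_congr hs fun m' ψ' hi s hs => ?_
    have h' := hsub _ _ _ _ h hi
    rw [hτ' m' ψ' s ((hD _ _).1 h').1 hs, hev _ _ _ h' hs]

/-! ### Tarski's conditions for satisfaction -/

theorem Evaluates.sat_iff {X D τ n φ s : M} (h : Evaluates X D τ) (hφ : PairIn D n φ)
    (hs : IsSeq X n s) : Sat X n φ s ↔ TrueBy τ n φ s := by
  rw [PowerlessSet.sat_iff]
  exact ⟨fun ⟨D', τ', h1, h2, h3⟩ => (h1.unique h h2 hφ hs).1 h3, fun h' => ⟨D, τ, h, hφ, h'⟩⟩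

theorem sat_memC {X n i j s : M} (hn : IsNat n) (hi : i ∊ n) (hj : j ∊ n) (hs : IsSeq X n s) :
    Sat X n (memC i j) s ↔ app s i ∊ app s j := by
  obtain ⟨D, τ, h, hφ⟩ := exists_evaluates X (isForm_memC hn hi hj)
  rw [h.sat_iff hφ hs, h.trueBy hφ hs, tcond_memC]
  simp only [hs.1.pairIn_iff]
  constructor
  · rintro ⟨_, _, ⟨-, rfl⟩, ⟨-, rfl⟩, h⟩
    exact h
  · exact fun h => ⟨_, _, ⟨hi, rfl⟩, ⟨hj, rfl⟩, h⟩

theorem sat_eqC {X n i j s : M} (hn : IsNat n) (hi : i ∊ n) (hj : j ∊ n) (hs : IsSeq X n s) :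
    Sat X n (eqC i j) s ↔ app s i = app s j := by
  obtain ⟨D, τ, h, hφ⟩ := exists_evaluates X (isForm_eqC hn hi hj)
  rw [h.sat_iff hφ hs, h.trueBy hφ hs, tcond_eqC]
  simp only [hs.1.pairIn_iff]
  constructor
  · rintro ⟨_, _, ⟨-, rfl⟩, ⟨-, rfl⟩, h⟩
    exact h
  · exact fun h => ⟨_, _, ⟨hi, rfl⟩, ⟨hj, rfl⟩, h⟩

theorem sat_negC {X n φ s : M} (hφ : IsForm n φ) (hs : IsSeq X n s) :
    Sat X n (negC φ) s ↔ ¬ Sat X n φ s := by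
  obtain ⟨D, τ, h, h'⟩ := exists_evaluates X hφ.negC
  rw [h.sat_iff h' hs, h.trueBy h' hs, tcond_negC, h.sat_iff (h.imm h' (.inl ⟨rfl, rfl⟩)) hs]

theorem sat_andC {X n φ ψ s : M} (hφ : IsForm n φ) (hψ : IsForm n ψ) (hs : IsSeq X n s) :
    Sat X n (andC φ ψ) s ↔ Sat X n φ s ∧ Sat X n ψ s := by
  obtain ⟨D, τ, h, h'⟩ := exists_evaluates X (hφ.andC hψ)
  rw [h.sat_iff h' hs, h.trueBy h' hs, tcond_andC,
    h.sat_iff (h.imm h' (.inr (.inl ⟨rfl, _, .inl rfl⟩))) hs,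
    h.sat_iff (h.imm h' (.inr (.inl ⟨rfl, _, .inr rfl⟩))) hs]

theorem sat_exC {X n φ s : M} (hφ : IsForm (succ n) φ) (hs : IsSeq X n s) :
    Sat X n (exC φ) s ↔ ∃ x, x ∊ X ∧ Sat X (succ n) φ (ext s n x) := by
  obtain ⟨D, τ, h, h'⟩ := exists_evaluates X hφ.exC
  rw [h.sat_iff h' hs, h.trueBy h' hs, tcond_exC]
  refine exists_congr fun x => and_congr_right fun hx => ?_
  rw [h.sat_iff (h.imm h' (.inr (.inr ⟨rfl, rfl⟩))) (hs.snoc hx)]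

/-! ### Relations definable over a set -/

/-- Over `X`, the class `A` of sequences of length `n` is defined by a formula of the model in the
context `n`. -/
def DRel (X n : M) (A : M → Prop) : Prop :=
  ∃ φ, IsForm n φ ∧ ∀ s, IsSeq X n s → (Sat X n φ s ↔ A s)

section

variable {X n : M} {A B : M → Prop}

theorem DRel.congr (h : DRel X n A) (h' : ∀ s, IsSeq X n s → (A s ↔ B s)) : DRel X n B := by
  obtain ⟨φ, hφ, h⟩ := h
  exact ⟨φ, hφ, fun s hs => (h s hs).trans (h' s hs)⟩

theorem drel_mem {i j : M} (hn : IsNat n) (hi : i ∊ n) (hj : j ∊ n) :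
    DRel X n (fun s => app s i ∊ app s j) :=
  ⟨memC i j, isForm_memC hn hi hj, fun _ => sat_memC hn hi hj⟩

theorem drel_eq {i j : M} (hn : IsNat n) (hi : i ∊ n) (hj : j ∊ n) :
    DRel X n (fun s => app s i = app s j) :=
  ⟨eqC i j, isForm_eqC hn hi hj, fun _ => sat_eqC hn hi hj⟩

theorem DRel.not (h : DRel X n A) : DRel X n (fun s => ¬ A s) := by
  obtain ⟨φ, hφ, h⟩ := h
  exact ⟨negC φ, hφ.negC, fun s hs => by rw [sat_negC hφ hs, h s hs]⟩

theorem DRel.and (h : DRel X n A) (h' : DRel X n B) : DRel X n (fun s => A s ∧ B s) := by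
  obtain ⟨φ, hφ, h⟩ := h
  obtain ⟨ψ, hψ, h'⟩ := h'
  exact ⟨andC φ ψ, hφ.andC hψ, fun s hs => by rw [sat_andC hφ hψ hs, h s hs, h' s hs]⟩

theorem DRel.imp (h : DRel X n A) (h' : DRel X n B) : DRel X n (fun s => A s → B s) :=
  (h.and h'.not).not.congr fun _ _ => by tauto

theorem DRel.or (h : DRel X n A) (h' : DRel X n B) : DRel X n (fun s => A s ∨ B s) :=
  (h.not.and h'.not).not.congr fun _ _ => by tauto

theorem DRel.iff (h : DRel X n A) (h' : DRel X n B) : DRel X n (fun s => A s ↔ B s) :=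
  ((h.imp h').and (h'.imp h)).congr fun _ _ => by tauto

theorem DRel.ex (h : DRel X (succ n) A) : DRel X n (fun s => ∃ x, x ∊ X ∧ A (ext s n x)) := by
  obtain ⟨φ, hφ, h⟩ := h
  refine ⟨exC φ, hφ.exC, fun s hs => ?_⟩
  rw [sat_exC hφ hs]
  exact exists_congr fun x => and_congr_right fun hx => h _ (hs.snoc hx)

theorem DRel.all (h : DRel X (succ n) A) : DRel X n (fun s => ∀ x, x ∊ X → A (ext s n x)) :=
  h.not.ex.not.congr fun _ _ => by push Not; rfl

end

set_option synthInstance.maxHeartbeats 400000 in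
set_option synthInstance.maxSize 2000 in
set_option maxHeartbeats 400000 in
/-- Translation of formulas evaluated over sets `Z` into formulas evaluated over a larger set `X`,
with a renaming `σ` of the free variables.  The set `Z` is related by `K` to the sequence `s` of
parameters, and is defined from it by the formulas supplied by `hKg`. -/
theorem exists_translation {X : M} (K : M → M → M → Prop)
    [hK : Dfb (fun w : Fin 3 → M => K (w 0) (w 1) (w 2))]
    (hKs : ∀ n s Z, K n s Z → Sub Z X)
    (hKe : ∀ n s x Z, IsSeq X n s → K n s Z → K (succ n) (ext s n x) Z)
    (hKg : ∀ n, IsNat n → ∃ γ, IsForm (succ n) γ ∧ ∀ s x Z, IsSeq X n s → x ∊ X → K n s Z →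
      (Sat X (succ n) γ (ext s n x) ↔ x ∊ Z))
    {m φ : M} (hφ : IsForm m φ) {n σ : M} (hn : IsNat n) (hσ : IsSeq n m σ) :
    ∃ φ', IsForm n φ' ∧ ∀ s t Z, IsSeq X n s → IsSeq Z m t → K n s Z →
      (∀ i, i ∊ m → app t i = app s (app σ i)) → (Sat X n φ' s ↔ Sat Z m φ t) := by
  have (m : ℕ) (a b c : (Fin m → M) → M) [DTm a] [DTm b] [DTm c] :
      Dfb (fun w => K (a w) (b w) (c w)) := hK.subst3 a b c
  refine form_induction (fun m φ => ∀ n σ, IsNat n → IsSeq n m σ →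
    ∃ φ', IsForm n φ' ∧ ∀ s t Z, IsSeq X n s → IsSeq Z m t → K n s Z →
      (∀ i, i ∊ m → app t i = app s (app σ i)) → (Sat X n φ' s ↔ Sat Z m φ t))
    ?_ ?_ ?_ ?_ ?_ m φ hφ n σ hn hσ
  · intro m i j hm hi hj n σ hn hσ
    refine ⟨memC (app σ i) (app σ j), isForm_memC hn (hσ.app_mem hi) (hσ.app_mem hj),
      fun s t Z hs ht _ h => ?_⟩
    rw [sat_memC hn (hσ.app_mem hi) (hσ.app_mem hj) hs, sat_memC hm hi hj ht, h i hi, h j hj]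
  · intro m i j hm hi hj n σ hn hσ
    refine ⟨eqC (app σ i) (app σ j), isForm_eqC hn (hσ.app_mem hi) (hσ.app_mem hj),
      fun s t Z hs ht _ h => ?_⟩
    rw [sat_eqC hn (hσ.app_mem hi) (hσ.app_mem hj) hs, sat_eqC hm hi hj ht, h i hi, h j hj]
  · intro m φ hφ ih n σ hn hσ
    obtain ⟨φ', hφ', h'⟩ := ih n σ hn hσ
    refine ⟨negC φ', hφ'.negC, fun s t Z hs ht hZ h => ?_⟩
    rw [sat_negC hφ' hs, sat_negC hφ ht, h' s t Z hs ht hZ h]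
  · intro m φ ψ hφ hψ ihφ ihψ n σ hn hσ
    obtain ⟨φ', hφ', h'⟩ := ihφ n σ hn hσ
    obtain ⟨ψ', hψ', h''⟩ := ihψ n σ hn hσ
    refine ⟨andC φ' ψ', hφ'.andC hψ', fun s t Z hs ht hZ h => ?_⟩
    rw [sat_andC hφ' hψ' hs, sat_andC hφ hψ ht, h' s t Z hs ht hZ h, h'' s t Z hs ht hZ h]
  · intro m φ hφ ih n σ hn hσ
    have hσ' : IsSeq (succ n) (succ m) (ext σ m n) :=
      (hσ.mono fun x hx => mem_succ.2 (.inl hx)).snoc (mem_succ.2 (.inr rfl))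
    obtain ⟨φ', hφ', h'⟩ := ih (succ n) (ext σ m n) hn.succ hσ'
    obtain ⟨γ, hγ, hγ'⟩ := hKg n hn
    refine ⟨exC (andC γ φ'), (hγ.andC hφ').exC, fun s t Z hs ht hZ h => ?_⟩
    have hZX := hKs _ _ _ hZ
    rw [sat_exC (hγ.andC hφ') hs, sat_exC hφ ht]
    have key : ∀ x, x ∊ Z → (Sat X (succ n) φ' (ext s n x) ↔ Sat Z (succ m) φ (ext t m x)) := by
      intro x hx
      refine h' _ _ Z (hs.snoc (hZX x hx)) (ht.snoc hx) (hKe _ _ _ _ hs hZ) fun i hi => ?_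
      rcases mem_succ.1 hi with hi | rfl
      · rw [ht.1.app_ext_of_mem hi, hσ.1.app_ext_of_mem hi, hs.1.app_ext_of_mem (hσ.app_mem hi),
          h i hi]
      · rw [ht.1.app_ext_self, hσ.1.app_ext_self, hs.1.app_ext_self]
    constructor
    · rintro ⟨x, hx, hx'⟩
      rw [sat_andC hγ hφ' (hs.snoc hx), hγ' s x Z hs hx hZ] at hx'
      exact ⟨x, hx'.1, (key x hx'.1).1 hx'.2⟩
    · rintro ⟨x, hx, hx'⟩
      refine ⟨x, hZX x hx, ?_⟩
      rw [sat_andC hγ hφ' (hs.snoc (hZX x hx)), hγ' s x Z hs (hZX x hx) hZ]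
      exact ⟨hx, (key x hx).2 hx'⟩

/-- Renaming of variables. -/
theorem DRel.rename {X m n σ : M} {A : M → Prop} (h : DRel X m A) (hn : IsNat n)
    (hσ : IsSeq n m σ) : ∃ B, DRel X n B ∧ ∀ s t, IsSeq X n s → IsSeq X m t →
      (∀ i, i ∊ m → app t i = app s (app σ i)) → (B s ↔ A t) := by
  obtain ⟨φ, hφ, h⟩ := h
  obtain ⟨φ', hφ', h'⟩ := exists_translation (X := X) (fun _ _ Z => Z = X)
    (fun _ _ Z hZ => by rw [hZ]; exact fun _ hx => hx) (fun _ _ _ _ _ hZ => hZ)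
    (fun n hn => ⟨eqC n n, isForm_eqC hn.succ (mem_succ.2 (.inr rfl)) (mem_succ.2 (.inr rfl)),
      fun s x Z hs hx hZ => by
        rw [sat_eqC hn.succ (mem_succ.2 (.inr rfl)) (mem_succ.2 (.inr rfl)) (hs.snoc hx), hZ]
        simp [hx]⟩) hφ hn hσ
  exact ⟨_, ⟨φ', hφ', fun _ _ => Iff.rfl⟩, fun s t hs ht hst =>
    (h' s t X hs ht rfl hst).trans (h t ht)⟩

/-- Relativization of a formula to the element `s_k` of the parameter sequence. -/
theorem exists_relativization {X m n σ k φ : M} (hφ : IsForm m φ) (hn : IsNat n) (hk : k ∊ n)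
    (hσ : IsSeq n m σ) : ∃ B, DRel X n B ∧ ∀ s t, IsSeq X n s → Sub (app s k) X →
      IsSeq (app s k) m t → (∀ i, i ∊ m → app t i = app s (app σ i)) →
      (B s ↔ Sat (app s k) m φ t) := by
  obtain ⟨φ', hφ', h'⟩ := exists_translation (X := X)
    (fun n s Z => k ∊ n ∧ Z = app s k ∧ Sub Z X) (fun _ _ Z hZ => hZ.2.2)
    (fun n s x Z hs hZ => ⟨mem_succ.2 (.inl hZ.1), by
      rw [hs.1.app_ext_of_mem hZ.1]; exact hZ.2.1, hZ.2.2⟩)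
    (fun n hn => by
      have hnn := mem_succ.2 (.inr (rfl : n = n))
      by_cases hk : k ∊ n
      · have hk' := mem_succ.2 (.inl (b := k = n) hk)
        refine ⟨memC n k, isForm_memC hn.succ hnn hk', fun s x Z hs hx hZ => ?_⟩
        rw [sat_memC hn.succ hnn hk' (hs.snoc hx), hs.1.app_ext_self,
          hs.1.app_ext_of_mem hk, hZ.2.1]
      · exact ⟨eqC n n, isForm_eqC hn.succ hnn hnn, fun s x Z hs hx hZ => absurd hZ.1 hk⟩)
    hφ hn hσ
  exact ⟨_, ⟨φ', hφ', fun _ _ => Iff.rfl⟩, fun s t hs hZ ht hst =>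
    h' s t _ hs ht ⟨hk, rfl, hZ⟩ hst⟩

/-! ### Definable subsets -/

theorem definableFrom_iff {X Y : M} {P : M → Prop} : DefinableFrom X P Y ↔
    ∃ n φ s, IsNat n ∧ IsForm (succ n) φ ∧ IsSeq X n s ∧ (∀ i, i ∊ n → P (app s i)) ∧
      ∀ y, y ∊ Y ↔ y ∊ X ∧ Sat X (succ n) φ (ext s n y) := by
  simp only [DefinableFrom, isSucc_iff, isExt_iff]
  constructor
  · rintro ⟨n, _, φ, s, hn, rfl, hφ, hs, hP, h⟩
    exact ⟨n, φ, s, hn, hφ, hs, fun i hi => hP i _ (hs.1.pairIn_iff.2 ⟨hi, rfl⟩), by simpa using h⟩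
  · rintro ⟨n, φ, s, hn, hφ, hs, hP, h⟩
    refine ⟨n, _, φ, s, hn, rfl, hφ, hs, fun i x hx => ?_, by simpa using h⟩
    obtain ⟨hi, rfl⟩ := hs.1.pairIn_iff.1 hx
    exact hP i hi

theorem DRel.definableFrom {X Y n s : M} {P A : M → Prop} (hA : DRel X (succ n) A) (hn : IsNat n)
    (hs : IsSeq X n s) (hP : ∀ i, i ∊ n → P (app s i)) (h : ∀ y, y ∊ Y ↔ y ∊ X ∧ A (ext s n y)) :
    DefinableFrom X P Y := by
  obtain ⟨φ, hφ, hA⟩ := hA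
  refine definableFrom_iff.2 ⟨n, φ, s, hn, hφ, hs, hP, fun y => ?_⟩
  rw [h y]
  exact and_congr_right fun hy => (hA _ (hs.snoc hy)).symm

theorem DefinableFrom.sub {X Y : M} {P : M → Prop} (h : DefinableFrom X P Y) : Sub Y X := by
  obtain ⟨n, n', φ, s, hn, hn', hφ, hs, hP, h⟩ := h
  exact fun y hy => ((h y).1 hy).1

theorem definableFrom_self (X : M) (P : M → Prop) : DefinableFrom X P X :=
  (drel_eq (X := X) (n := num M 1) (i := num M 0) (j := num M 0) (isNat_num 1)
    (by simp) (by simp)).definableFrom (n := num M 0) (isNat_num 0) isSeq_emp (by simp [num])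
    fun y => by simp

theorem definableFrom_of_mem {X x : M} (hX : IsTransitive X) (hx : x ∊ X) :
    DefinableFrom X (fun _ => True) x := by
  have h0 : IsSeq X (num M 0) (emp M) := isSeq_emp
  have h1 : IsSeq X (num M 1) (ext (emp M) (num M 0) x) := h0.snoc hx
  refine (drel_mem (X := X) (n := num M 2) (i := num M 1) (j := num M 0) (isNat_num 2)
    (by simp) (by simp)).definableFrom (n := num M 1) (isNat_num 1) h1 (fun _ _ => trivial)
    fun y => ?_
  rw [h1.1.app_ext_self, h1.1.app_ext_of_mem (by simp), h0.1.app_ext_self]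
  exact ⟨fun hy => ⟨hX x hx y hy, hy⟩, fun h => h.2⟩

/-- The ordinals of a transitive set form a definable subset. -/
theorem definableFrom_ordinals {X Y : M} (P : M → Prop) (hX : IsTransitive X)
    (h : ∀ y, y ∊ Y ↔ y ∊ X ∧ IsOrd y) : DefinableFrom X P Y := by
  have hA : DRel X (num M 1) (fun s => IsOrd (app s (num M 0))) := by
    have mem3 (i j : ℕ) (hi : i < 3) (hj : j < 3) :
        DRel X (num M 3) (fun s => app s (num M i) ∊ app s (num M j)) :=
      drel_mem (isNat_num 3) (num_mem_num.2 hi) (num_mem_num.2 hj)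
    have mem2 : DRel X (num M 2) (fun s => app s (num M 1) ∊ app s (num M 0)) :=
      drel_mem (isNat_num 2) (by simp) (by simp)
    have eq3 : DRel X (num M 3) (fun s => app s (num M 1) = app s (num M 2)) :=
      drel_eq (isNat_num 3) (by simp) (by simp)
    have h1 := (mem2.imp (DRel.all (n := num M 2)
      ((mem3 2 1 (by simp) (by simp)).imp (mem3 2 0 (by simp) (by simp))))).all (n := num M 1)
    have h2 := (mem2.imp (DRel.all (n := num M 2) ((mem3 2 0 (by simp) (by simp)).imp
      ((mem3 1 2 (by simp) (by simp)).or (eq3.or (mem3 2 1 (by simp) (by simp))))))).all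
        (n := num M 1)
    refine (h1.and h2).congr fun s hs => ?_
    set a := app s (num M 0) with ha
    have haX : a ∊ X := hs.app_mem (by simp)
    have e1 : ∀ y, app (ext s (num M 1) y) (num M 1) = y := fun y => hs.1.app_ext_self
    have e0 : ∀ y, app (ext s (num M 1) y) (num M 0) = a := fun y =>
      hs.1.app_ext_of_mem (by simp)
    have hs2 : ∀ y, IsFun (ext s (num M 1) y) (num M 2) := fun y => hs.1.snoc y
    have f2 : ∀ y z, app (ext (ext s (num M 1) y) (num M 2) z) (num M 2) = z :=
      fun y z => (hs2 y).app_ext_self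
    have f1 : ∀ y z, app (ext (ext s (num M 1) y) (num M 2) z) (num M 1) = y := fun y z => by
      rw [(hs2 y).app_ext_of_mem (by simp), e1]
    have f0 : ∀ y z, app (ext (ext s (num M 1) y) (num M 2) z) (num M 0) = a := fun y z => by
      rw [(hs2 y).app_ext_of_mem (by simp), e0]
    simp only [e1, e0, f2, f1, f0]
    constructor
    · rintro ⟨g1, g2⟩
      exact ⟨fun y hy z hz => g1 y (hX a haX y hy) hy z (hX y (hX a haX y hy) z hz) hz,
        fun x y hx hy => g2 x (hX a haX x hx) hx y (hX a haX y hy) hy⟩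
    · exact fun g => ⟨fun y _ hy z _ hz => g.1 y hy z hz, fun x _ hx y _ hy => g.2 x y hx hy⟩
  have h0 : IsSeq X (num M 0) (emp M) := isSeq_emp
  refine hA.definableFrom (n := num M 0) (isNat_num 0) h0 (by simp [num]) fun y => ?_
  rw [h0.1.app_ext_self]
  exact h y

/-! ### The constructible hierarchy: recursion equations -/

theorem IsDef.unique {D D' X : M} (h : IsDef D X) (h' : IsDef D' X) : D = D' :=
  ext_iff.2 fun Y => (h Y).trans (h' Y).symm

theorem isLSequence_iff {f δ : M} : IsLSequence f δ ↔ IsOrd δ ∧ IsFun f δ ∧ ∀ β, β ∊ δ →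
    (β = emp M → app f β = emp M) ∧
    (∀ γ, β = succ γ → IsDef (app f β) (app f γ)) ∧
    (IsLimitOrd β → ∀ w, w ∊ app f β ↔ ∃ γ, γ ∊ β ∧ w ∊ app f γ) := by
  unfold IsLSequence
  simp only [isSucc_iff, isEmptySet_iff]
  refine and_congr_right fun hδ => and_congr_right fun hf => ?_
  simp only [hf.pairIn_iff]
  constructor
  · intro h β hβ
    obtain ⟨h1, h2, h3⟩ := h β _ ⟨hβ, rfl⟩
    refine ⟨h1, ?_, fun hl w => (h3 hl w).trans ?_⟩
    · rintro γ rfl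
      exact h2 γ _ rfl ⟨hδ.1 _ hβ _ (mem_succ.2 (.inr rfl)), rfl⟩
    · exact ⟨fun ⟨γ, z, h1, h2, h3⟩ => ⟨γ, h1, h2.2 ▸ h3⟩,
        fun ⟨γ, h1, h2⟩ => ⟨γ, _, h1, ⟨hδ.1 _ hβ _ h1, rfl⟩, h2⟩⟩
  · rintro h β y ⟨hβ, rfl⟩
    obtain ⟨h1, h2, h3⟩ := h β hβ
    refine ⟨h1, ?_, fun hl w => (h3 hl w).trans ?_⟩
    · rintro γ z rfl ⟨-, rfl⟩
      exact h2 γ rfl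
    · exact ⟨fun ⟨γ, h1, h2⟩ => ⟨γ, _, h1, ⟨hδ.1 _ hβ _ h1, rfl⟩, h2⟩,
        fun ⟨γ, z, h1, h2, h3⟩ => ⟨γ, h1, h2.2 ▸ h3⟩⟩

theorem isL_iff {α x : M} :
    IsL α x ↔ IsOrd α ∧ ∃ f, IsLSequence f (succ α) ∧ app f α = x := by
  unfold IsL
  simp only [isSucc_iff]
  refine and_congr_right fun _ => ⟨?_, ?_⟩
  · rintro ⟨_, f, rfl, hf, hx⟩
    exact ⟨f, hf, (hf.2.1.pairIn_iff.1 hx).2⟩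
  · rintro ⟨f, hf, hx⟩
    exact ⟨_, f, rfl, hf, hf.2.1.pairIn_iff.2 ⟨mem_succ.2 (.inr rfl), hx⟩⟩

theorem IsLSequence.unique {f g δ δ' β : M} (hf : IsLSequence f δ) (hg : IsLSequence g δ')
    (hβ : β ∊ δ) (hβ' : β ∊ δ') : app f β = app g β := by
  obtain ⟨hδ, -, hf⟩ := isLSequence_iff.1 hf
  obtain ⟨hδ', -, hg⟩ := isLSequence_iff.1 hg
  refine mem_induction (fun β => β ∊ δ → β ∊ δ' → app f β = app g β) ?_ β hβ hβ'
  intro β ih hβ hβ'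
  have ih' : ∀ γ, γ ∊ β → app f γ = app g γ := fun γ hγ =>
    ih γ hγ (hδ.1 _ hβ _ hγ) (hδ'.1 _ hβ' _ hγ)
  obtain ⟨h1, h2, h3⟩ := hf β hβ
  obtain ⟨h1', h2', h3'⟩ := hg β hβ'
  rcases (hδ.mem hβ).cases with rfl | ⟨γ, -, rfl⟩ | hl
  · rw [h1 rfl, h1' rfl]
  · have := h2 γ rfl
    rw [ih' γ (mem_succ.2 (.inr rfl))] at this
    exact this.unique (h2' γ rfl)
  · refine ext_iff.2 fun w => ?_
    rw [h3 hl, h3' hl]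
    exact exists_congr fun γ => and_congr_right fun hγ => by rw [ih' γ hγ]

theorem IsL.unique {α x y : M} (hx : IsL α x) (hy : IsL α y) : x = y := by
  obtain ⟨-, f, hf, rfl⟩ := isL_iff.1 hx
  obtain ⟨-, g, hg, rfl⟩ := isL_iff.1 hy
  exact hf.unique hg (mem_succ.2 (.inr rfl)) (mem_succ.2 (.inr rfl))

theorem IsLSequence.isL {f δ β : M} (hf : IsLSequence f δ) (hβ : β ∊ δ) : IsL β (app f β) := by
  obtain ⟨hδ, hfun, hf⟩ := isLSequence_iff.1 hf
  have hβo := hδ.mem hβ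
  have hsub : Sub (succ β) δ := fun γ hγ => by
    rcases mem_succ.1 hγ with hγ | rfl
    exacts [hδ.1 _ hβ _ hγ, hβ]
  obtain ⟨g, hg, hgf⟩ := hfun.restrict hsub
  refine isL_iff.2 ⟨hβo, g, isLSequence_iff.2 ⟨hβo.succ, hg, fun γ hγ => ?_⟩,
    hgf _ (mem_succ.2 (.inr rfl))⟩
  obtain ⟨h1, h2, h3⟩ := hf γ (hsub _ hγ)
  rw [hgf γ hγ]
  refine ⟨h1, ?_, fun hl w => (h3 hl w).trans ?_⟩
  · rintro ξ rfl
    rw [hgf ξ (hβo.succ.1 _ hγ _ (mem_succ.2 (.inr rfl)))]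
    exact h2 ξ rfl
  · exact exists_congr fun ξ => and_congr_right fun hξ => by rw [hgf ξ (hβo.succ.1 _ hγ _ hξ)]

/-- The recursion equations of the hierarchy, without reference to sequences. -/
theorem IsL.recursion {α x : M} (h : IsL α x) :
    (∀ β, β ∊ α → ∃ y, IsL β y) ∧ (α = emp M → x = emp M) ∧
    (∀ γ z, α = succ γ → IsL γ z → IsDef x z) ∧
    (IsLimitOrd α → ∀ w, w ∊ x ↔ ∃ γ z, γ ∊ α ∧ IsL γ z ∧ w ∊ z) := by
  obtain ⟨hα, f, hf, rfl⟩ := isL_iff.1 h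
  have hL : ∀ β, β ∊ α → IsL β (app f β) := fun β hβ => hf.isL (mem_succ.2 (.inl hβ))
  obtain ⟨-, -, hf'⟩ := isLSequence_iff.1 hf
  obtain ⟨h1, h2, h3⟩ := hf' α (mem_succ.2 (.inr rfl))
  refine ⟨fun β hβ => ⟨_, hL β hβ⟩, h1, ?_, fun hl w => (h3 hl w).trans ?_⟩
  · rintro γ z rfl hz
    rw [hz.unique (hL γ (mem_succ.2 (.inr rfl)))]
    exact h2 γ rfl
  · exact ⟨fun ⟨γ, hγ, hw⟩ => ⟨γ, _, hγ, hL γ hγ, hw⟩,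
      fun ⟨γ, z, hγ, hz, hw⟩ => ⟨γ, hγ, (hz.unique (hL γ hγ)) ▸ hw⟩⟩

/-- A set satisfying the recursion equation for `L_α` is `L_α`, provided the sequence
`⟨L_γ : γ < α⟩` consists of elements of it (so that this sequence is a set). -/
theorem isL_intro {α y : M} (hα : IsOrd α) (hL : ∀ γ, γ ∊ α → ∃ z, IsL γ z ∧ z ∊ y)
    (h1 : α = emp M → y = emp M) (h2 : ∀ γ z, α = succ γ → IsL γ z → IsDef y z)
    (h3 : IsLimitOrd α → ∀ w, w ∊ y ↔ ∃ γ z, γ ∊ α ∧ IsL γ z ∧ w ∊ z) : IsL α y := by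
  obtain ⟨f, hf, hf'⟩ := exists_seq (fun γ z : M => (γ ∊ α ∧ IsL γ z) ∨ (γ = α ∧ z = y))
    (X := succ y) (n := succ α) (fun γ hγ => by
      rcases mem_succ.1 hγ with hγ | rfl
      · obtain ⟨z, hz, hzy⟩ := hL γ hγ
        exact ⟨z, mem_succ.2 (.inl hzy), .inl ⟨hγ, hz⟩⟩
      · exact ⟨y, mem_succ.2 (.inr rfl), .inr ⟨rfl, rfl⟩⟩) (by
      rintro γ x x' - (⟨hγ, h⟩ | ⟨rfl, rfl⟩) (⟨hγ', h'⟩ | ⟨h'', rfl⟩)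
      · exact h.unique h'
      · exact absurd (h'' ▸ hγ) (not_mem_self _)
      · exact absurd hγ' (not_mem_self _)
      · rfl)
  have hfα : app f α = y := by
    rcases hf' α (mem_succ.2 (.inr rfl)) with h | h
    exacts [absurd h.1 (not_mem_self _), h.2]
  have hfL : ∀ γ, γ ∊ α → IsL γ (app f γ) := fun γ hγ => by
    rcases hf' γ (mem_succ.2 (.inl hγ)) with h | h
    exacts [h.2, absurd (h.1 ▸ hγ) (not_mem_self _)]
  refine isL_iff.2 ⟨hα, f, isLSequence_iff.2 ⟨hα.succ, hf.1, fun β hβ => ?_⟩, hfα⟩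
  rcases mem_succ.1 hβ with hβ | rfl
  · obtain ⟨-, g1, g2, g3⟩ := (hfL β hβ).recursion
    refine ⟨g1, ?_, fun hl w => (g3 hl w).trans ?_⟩
    · rintro γ rfl
      exact g2 γ _ rfl (hfL γ (hα.1 _ hβ _ (mem_succ.2 (.inr rfl))))
    · exact ⟨fun ⟨γ, z, hγ, hz, hw⟩ => ⟨γ, hγ, (hz.unique (hfL γ (hα.1 _ hβ _ hγ))) ▸ hw⟩,
        fun ⟨γ, hγ, hw⟩ => ⟨γ, _, hγ, hfL γ (hα.1 _ hβ _ hγ), hw⟩⟩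
  · rw [hfα]
    refine ⟨h1, ?_, fun hl w => (h3 hl w).trans ?_⟩
    · rintro γ rfl
      exact h2 γ _ rfl (hfL γ (mem_succ.2 (.inr rfl)))
    · exact ⟨fun ⟨γ, z, hγ, hz, hw⟩ => ⟨γ, hγ, (hz.unique (hfL γ hγ)) ▸ hw⟩,
        fun ⟨γ, hγ, hw⟩ => ⟨γ, _, hγ, hfL γ hγ, hw⟩⟩

/-! ### Transitivity, monotonicity, and the ordinals of `L_α` -/

theorem IsDef.self_mem {D X : M} (h : IsDef D X) : X ∊ D := (h X).2 (definableFrom_self X _)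

theorem IsDef.sub {D X : M} (h : IsDef D X) (hX : IsTransitive X) : Sub X D :=
  fun x hx => (h x).2 (definableFrom_of_mem hX hx)

theorem IsDef.transitive {D X : M} (h : IsDef D X) (hX : IsTransitive X) : IsTransitive D :=
  fun Y hY x hx => h.sub hX x (((h Y).1 hY).sub x hx)

theorem IsL.transitive_and_mono {α x : M} (h : IsL α x) :
    IsTransitive x ∧ ∀ β, β ∊ α → ∀ y, IsL β y → y ∊ x ∧ Sub y x := by
  refine mem_induction (fun α => ∀ x, IsL α x → IsTransitive x ∧
    ∀ β, β ∊ α → ∀ y, IsL β y → y ∊ x ∧ Sub y x) ?_ α x h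
  intro α ih x h
  obtain ⟨h0, h1, h2, h3⟩ := h.recursion
  rcases h.1.cases with rfl | ⟨γ, -, rfl⟩ | hl
  · rw [h1 rfl]
    simp [IsTransitive]
  · obtain ⟨z, hz⟩ := h0 γ (mem_succ.2 (.inr rfl))
    obtain ⟨hzt, hzm⟩ := ih γ (mem_succ.2 (.inr rfl)) z hz
    have hd := h2 γ z rfl hz
    refine ⟨hd.transitive hzt, fun β hβ y hy => ?_⟩
    rcases mem_succ.1 hβ with hβ | rfl
    · obtain ⟨g1, g2⟩ := hzm β hβ y hy
      exact ⟨hd.sub hzt y g1, fun w hw => hd.sub hzt w (g2 w hw)⟩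
    · rw [hy.unique hz]
      exact ⟨hd.self_mem, hd.sub hzt⟩
  · refine ⟨fun y hy w hw => ?_, fun β hβ y hy => ⟨?_, fun w hw => ?_⟩⟩
    · obtain ⟨γ, z, hγ, hz, hyz⟩ := (h3 hl y).1 hy
      exact (h3 hl w).2 ⟨γ, z, hγ, hz, (ih γ hγ z hz).1 y hyz w hw⟩
    · have hβ' := hl.succ_mem hβ
      obtain ⟨z, hz⟩ := h0 _ hβ'
      exact (h3 hl y).2 ⟨_, z, hβ', hz, ((ih _ hβ' z hz).2 β (mem_succ.2 (.inr rfl)) y hy).1⟩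
    · exact (h3 hl w).2 ⟨β, y, hβ, hy, hw⟩

theorem IsL.transitive {α x : M} (h : IsL α x) : IsTransitive x := h.transitive_and_mono.1

theorem IsL.mem {α β x y : M} (hx : IsL α x) (hy : IsL β y) (h : α ∊ β) : x ∊ y :=
  (hy.transitive_and_mono.2 α h x hx).1

theorem IsL.sub {α β x y : M} (hx : IsL α x) (hy : IsL β y) (h : α ∊ β) : Sub x y :=
  (hy.transitive_and_mono.2 α h x hx).2

theorem IsL.injective {α β x : M} (hα : IsL α x) (hβ : IsL β x) : α = β := by
  rcases hα.1.trichotomy hβ.1 with h | h | h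
  · exact absurd (hα.mem hβ h) (not_mem_self _)
  · exact h
  · exact absurd (hβ.mem hα h) (not_mem_self _)

/-- The ordinals in `L_α` are exactly the elements of `α`. -/
theorem IsL.ordinals {α x : M} (h : IsL α x) (β : M) : β ∊ x ∧ IsOrd β ↔ β ∊ α := by
  refine mem_induction (fun α => ∀ x, IsL α x → ∀ β, (β ∊ x ∧ IsOrd β ↔ β ∊ α)) ?_ α x h β
  intro α ih x h β
  obtain ⟨h0, h1, h2, h3⟩ := h.recursion
  rcases h.1.cases with rfl | ⟨γ, hγo, rfl⟩ | hl
  · rw [h1 rfl]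
    simp
  · obtain ⟨z, hz⟩ := h0 γ (mem_succ.2 (.inr rfl))
    have ihz := ih γ (mem_succ.2 (.inr rfl)) z hz
    have hd := h2 γ z rfl hz
    have hγ : γ ∊ x := (hd γ).2 (definableFrom_ordinals _ hz.transitive fun y => (ihz y).symm)
    constructor
    · rintro ⟨hβ, hβo⟩
      rw [mem_succ]
      rcases hβo.trichotomy hγo with h | h | h
      · exact .inl h
      · exact .inr h
      · exact absurd ((ihz γ).1 ⟨((hd β).1 hβ).sub γ h, hγo⟩) (not_mem_self _)
    · intro hβ
      refine ⟨?_, h.1.mem hβ⟩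
      rcases mem_succ.1 hβ with hβ | rfl
      · exact hd.sub hz.transitive β ((ihz β).2 hβ).1
      · exact hγ
  · rw [h3 hl]
    constructor
    · rintro ⟨⟨γ, z, hγ, hz, hβ⟩, hβo⟩
      exact h.1.1 _ hγ _ ((ih γ hγ z hz β).1 ⟨hβ, hβo⟩)
    · intro hβ
      have hβ' := hl.succ_mem hβ
      obtain ⟨z, hz⟩ := h0 _ hβ'
      obtain ⟨g1, g2⟩ := (ih _ hβ' z hz β).2 (mem_succ.2 (.inr rfl))
      exact ⟨⟨_, z, hβ', hz, g1⟩, g2⟩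

/-! ### Eliminating parameters in favour of levels of the hierarchy -/

/-- `{p}` is defined over `X` by a formula with parameters satisfying `Q`. -/
def PointDefinable (X : M) (Q : M → Prop) (p : M) : Prop :=
  ∃ n A s, IsNat n ∧ DRel X (succ n) A ∧ IsSeq X n s ∧ (∀ i, i ∊ n → Q (app s i)) ∧
    ∀ y, y ∊ X → (A (ext s n y) ↔ y = p)

set_option synthInstance.maxHeartbeats 400000 in
set_option synthInstance.maxSize 2000 in
/-- A sequence `r` can be extended by values of a second sequence `u` so that `u` becomes a
reindexing of the extension. -/
theorem IsSeq.exists_extension {X n r m u : M} (hn : IsNat n) (hr : IsSeq X n r) (hm : IsNat m)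
    (hu : IsSeq X m u) : ∃ N w τ, IsNat N ∧ Sub n N ∧ IsSeq X N w ∧
      (∀ i, i ∊ n → app w i = app r i) ∧
      (∀ i, i ∊ N → ¬ i ∊ n → ∃ j, j ∊ m ∧ app w i = app u j) ∧
      IsSeq N m τ ∧ ∀ j, j ∊ m → app w (app τ j) = app u j := by
  refine nat_induction (fun m => ∀ u, IsSeq X m u → ∃ N w τ, IsNat N ∧ Sub n N ∧ IsSeq X N w ∧
      (∀ i, i ∊ n → app w i = app r i) ∧
      (∀ i, i ∊ N → ¬ i ∊ n → ∃ j, j ∊ m ∧ app w i = app u j) ∧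
      IsSeq N m τ ∧ ∀ j, j ∊ m → app w (app τ j) = app u j) ?_ ?_ m hm u hu
  · exact fun u _ => ⟨n, r, emp M, hn, fun _ h => h, hr, fun _ _ => rfl,
      fun i hi hi' => absurd hi hi', isSeq_emp, by simp⟩
  · intro m _ ih v hv
    obtain ⟨u, x, hu, hx, rfl⟩ := hv.exists_eq_ext
    obtain ⟨N, w, τ, hN, hnN, hw, h1, h2, hτ, h3⟩ := ih u hu
    refine ⟨succ N, ext w N x, ext τ m N, hN.succ, fun i hi => mem_succ.2 (.inl (hnN i hi)),
      hw.snoc hx, fun i hi => ?_, fun i hi hi' => ?_,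
      (hτ.mono fun i hi => mem_succ.2 (.inl hi)).snoc (mem_succ.2 (.inr rfl)), fun j hj => ?_⟩
    · rw [hw.1.app_ext_of_mem (hnN i hi), h1 i hi]
    · rcases mem_succ.1 hi with hi | rfl
      · obtain ⟨j, hj, e⟩ := h2 i hi hi'
        exact ⟨j, mem_succ.2 (.inl hj), by
          rw [hw.1.app_ext_of_mem hi, hu.1.app_ext_of_mem hj, e]⟩
      · exact ⟨m, mem_succ.2 (.inr rfl), by rw [hw.1.app_ext_self, hu.1.app_ext_self]⟩
    · rcases mem_succ.1 hj with hj | rfl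
      · rw [hτ.1.app_ext_of_mem hj, hw.1.app_ext_of_mem (hτ.app_mem hj), h3 j hj,
          hu.1.app_ext_of_mem hj]
      · rw [hτ.1.app_ext_self, hw.1.app_ext_self, hu.1.app_ext_self]

set_option synthInstance.maxHeartbeats 400000 in
set_option synthInstance.maxSize 2000 in
/-- One parameter `r_k`, definable from parameters satisfying `Q`, is eliminated: its place is taken
by an arbitrary `q` satisfying `Q`, and the parameters of its definition are appended. -/
theorem exists_eliminate {X n φ r k q : M} {Q : M → Prop} (hn : IsNat n) (hφ : IsForm (succ n) φ)
    (hr : IsSeq X n r) (hk : k ∊ n) (ha : PointDefinable X Q (app r k)) (hq : q ∊ X) (hQ : Q q) :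
    ∃ N ψ w, IsNat N ∧ IsForm (succ N) ψ ∧ IsSeq X N w ∧
      (∀ i, i ∊ N → Q (app w i) ∨ (i ∊ n ∧ i ≠ k ∧ app w i = app r i)) ∧
      ∀ y, y ∊ X → (Sat X (succ N) ψ (ext w N y) ↔ Sat X (succ n) φ (ext r n y)) := by
  obtain ⟨m, A, u, hm, hA, hu, huQ, hua⟩ := ha
  obtain ⟨r', hr', hr''⟩ := exists_seq
    (fun i x : M => (i = k ∧ x = q) ∨ (i ≠ k ∧ x = app r i)) (X := X) (n := n)
    (fun i hi => by
      by_cases h : i = k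
      exacts [⟨q, hq, .inl ⟨h, rfl⟩⟩, ⟨_, hr.app_mem hi, .inr ⟨h, rfl⟩⟩]) (by grind)
  obtain ⟨N, w, τ, hN, hnN, hw, h1, h2, hτ, h3⟩ := hr'.exists_extension hn hm hu
  have hNN : N ∊ succ N := mem_succ.2 (.inr rfl)
  have hNN' : N ∊ succ (succ N) := mem_succ.2 (.inl hNN)
  have hNN'' : succ N ∊ succ (succ N) := mem_succ.2 (.inr rfl)
  have hup : ∀ i, i ∊ N → i ∊ succ (succ N) := fun i hi => mem_succ.2 (.inl (mem_succ.2 (.inl hi)))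
  -- in the new formula the value of the eliminated parameter is the bound variable `v_{N+1}`
  obtain ⟨σ, hσ, hσ'⟩ := exists_seq
    (fun i j : M => (i = k ∧ j = succ N) ∨ (i ≠ k ∧ j = i)) (X := succ (succ N)) (n := n)
    (fun i hi => by
      by_cases h : i = k
      exacts [⟨_, hNN'', .inl ⟨h, rfl⟩⟩, ⟨i, hup i (hnN i hi), .inr ⟨h, rfl⟩⟩]) (by grind)
  obtain ⟨B, hB, hB'⟩ := hA.rename (n := succ (succ N)) (σ := ext τ m (succ N)) hN.succ.succ
    ((hτ.mono hup).snoc hNN'')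
  obtain ⟨C, hC, hC'⟩ := DRel.rename (X := X) ⟨φ, hφ, fun _ _ => Iff.rfl⟩
    (n := succ (succ N)) (σ := ext σ n N) hN.succ.succ (hσ.snoc hNN')
  obtain ⟨ψ, hψ, hψ'⟩ := (hB.and hC).ex
  refine ⟨N, ψ, w, hN, hψ, hw, fun i hi => ?_, fun y hy => ?_⟩
  · by_cases hi' : i ∊ n
    · rcases hr'' i hi' with ⟨-, h⟩ | ⟨h, h'⟩
      · exact .inl (by rw [h1 i hi', h]; exact hQ)
      · exact .inr ⟨hi', h, by rw [h1 i hi', h']⟩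
    · obtain ⟨j, hj, e⟩ := h2 i hi hi'
      exact .inl (e ▸ huQ j hj)
  rw [hψ' _ (hw.snoc hy)]
  have hs : ∀ x, x ∊ X → IsSeq X (succ (succ N)) (ext (ext w N y) (succ N) x) :=
    fun x hx => (hw.snoc hy).snoc hx
  have e0 : ∀ x i, i ∊ N → app (ext (ext w N y) (succ N) x) i = app w i := fun x i hi => by
    rw [(hw.1.snoc y).app_ext_of_mem (mem_succ.2 (.inl hi)), hw.1.app_ext_of_mem hi]
  have e1 : ∀ x, app (ext (ext w N y) (succ N) x) N = y := fun x => by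
    rw [(hw.1.snoc y).app_ext_of_mem hNN, hw.1.app_ext_self]
  have e2 : ∀ x, app (ext (ext w N y) (succ N) x) (succ N) = x := fun x =>
    (hw.1.snoc y).app_ext_self
  have hBx : ∀ x, x ∊ X → (B (ext (ext w N y) (succ N) x) ↔ x = app r k) := by
    intro x hx
    rw [← hua x hx]
    refine hB' _ _ (hs x hx) (hu.snoc hx) fun i hi => ?_
    rcases mem_succ.1 hi with hi | rfl
    · rw [hu.1.app_ext_of_mem hi, hτ.1.app_ext_of_mem hi, e0 x _ (hτ.app_mem hi), h3 i hi]
    · rw [hu.1.app_ext_self, hτ.1.app_ext_self, e2]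
  have hCx : C (ext (ext w N y) (succ N) (app r k)) ↔ Sat X (succ n) φ (ext r n y) := by
    refine hC' _ _ (hs _ (hr.app_mem hk)) (hr.snoc hy) fun i hi => ?_
    rcases mem_succ.1 hi with hi | rfl
    · rw [hr.1.app_ext_of_mem hi, hσ.1.app_ext_of_mem hi]
      rcases hσ' i hi with ⟨rfl, e⟩ | ⟨hik, e⟩
      · rw [e, e2]
      · rw [e, e0 _ i (hnN i hi), h1 i hi]
        rcases hr'' i hi with h | h
        exacts [absurd h.1 hik, h.2.symm]
    · rw [hr.1.app_ext_self, hσ.1.app_ext_self, e1]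
  constructor
  · rintro ⟨x, hx, hxB, hxC⟩
    rw [hBx x hx] at hxB
    subst hxB
    exact hCx.1 hxC
  · exact fun h => ⟨_, hr.app_mem hk, (hBx _ (hr.app_mem hk)).2 rfl, hCx.2 h⟩

set_option synthInstance.maxHeartbeats 400000 in
set_option synthInstance.maxSize 2000 in
/-- If every element of `X` is definable over `X` from parameters satisfying `Q`, then every set
definable over `X` is definable from such parameters. -/
theorem DefinableFrom.of_pointDefinable {X Y : M} (Q : M → Prop)
    [hQ : Dfb (fun w : Fin 1 → M => Q (w 0))] (h : ∀ p, p ∊ X → PointDefinable X Q p)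
    (hne : ∀ p, p ∊ X → ∃ q, q ∊ X ∧ Q q) (hY : DefinableFrom X (fun _ => True) Y) :
    DefinableFrom X Q Y := by
  have (m : ℕ) (a : (Fin m → M) → M) [DTm a] : Dfb (fun w => Q (a w)) := hQ.subst1 a
  -- the parameters with index `< k` are those that remain to be eliminated
  have key := nat_induction (fun k => ∀ n φ r : M, IsNat n → IsForm (succ n) φ → IsSeq X n r →
    (∀ i, i ∊ n → ¬ i ∊ k → Q (app r i)) →
    (∀ y, y ∊ Y ↔ y ∊ X ∧ Sat X (succ n) φ (ext r n y)) → DefinableFrom X Q Y) ?_ ?_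
  · obtain ⟨n, φ, s, hn, hφ, hs, -, hY⟩ := definableFrom_iff.1 hY
    exact key n hn n φ s hn hφ hs (fun i hi hi' => absurd hi hi') hY
  · intro n φ r hn hφ hr hb hY
    exact definableFrom_iff.2 ⟨n, φ, r, hn, hφ, hr, fun i hi => hb i hi not_mem_emp, hY⟩
  · intro k _ ih n φ r hn hφ hr hb hY
    by_cases hkn : k ∊ n
    · have ha := hr.app_mem hkn
      obtain ⟨q, hq, hqQ⟩ := hne _ ha
      obtain ⟨N, ψ, w, hN, hψ, hw, hwQ, he⟩ :=
        exists_eliminate hn hφ hr hkn (h _ ha) hq hqQ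
      refine ih N ψ w hN hψ hw (fun i hi hik => ?_) fun y => ?_
      · rcases hwQ i hi with h | ⟨hin, hik', e⟩
        · exact h
        · rw [e]
          exact hb i hin fun h => (mem_succ.1 h).elim hik hik'
      · rw [hY y]
        exact and_congr_right fun hy => (he y hy).symm
    · refine ih n φ r hn hφ hr (fun i hi hik => hb i hi fun h => ?_) hY
      rcases mem_succ.1 h with h | rfl
      exacts [hik h, hkn hi]

/-- `Y` is definable over `X` from parameters of the form `L_δ` with `δ < γ`. -/
def LDefinable (γ X Y : M) : Prop := DefinableFrom X (fun q => ∃ δ, δ ∊ γ ∧ IsL δ q) Y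

set_option synthInstance.maxHeartbeats 400000 in
set_option synthInstance.maxSize 2000 in
instance {n : ℕ} (a b c : (Fin n → M) → M) [DTm a] [DTm b] [DTm c] :
    Dfb (fun w => LDefinable (a w) (b w) (c w)) :=
  Dfb.subst3 (by simp only [LDefinable, definableFrom_iff]; infer_instance) a b c

/-- If `p` is definable over `L_γ` from earlier levels, and `γ < α`, then `{p}` is definable over
`L_α` from the same levels and `L_γ`, by relativizing the definition of `p` to `L_γ`. -/
theorem LDefinable.pointDefinable {α x γ z p : M} (hx : IsL α x) (hγ : γ ∊ α) (hz : IsL γ z)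
    (hp : LDefinable γ z p) (hpx : p ∊ x) :
    PointDefinable x (fun q => ∃ δ, δ ∊ α ∧ IsL δ q) p := by
  obtain ⟨m, φ, u, hm, hφ, hu, huQ, hp⟩ := definableFrom_iff.1 hp
  have hzx := hz.sub hx hγ
  have hux := hu.mono hzx
  have hs := hux.snoc (hz.mem hx hγ)
  obtain ⟨id, hid, hid'⟩ := exists_seq_of_term (fun i : M => i) (X := m) (n := m) fun _ h => h
  have hN : IsNat (succ (succ (succ m))) := hm.succ.succ.succ
  have m0 : m ∊ succ (succ (succ m)) := by simp
  have m1 : succ m ∊ succ (succ (succ m)) := by simp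
  have m2 : succ (succ m) ∊ succ (succ (succ m)) := by simp
  have hσ : IsSeq (succ (succ (succ m))) (succ m) (ext id m (succ (succ m))) :=
    (hid.mono fun i hi => by simp [hi]).snoc m2
  obtain ⟨B, hB, hB'⟩ := exists_relativization (X := x) hφ hN m0 hσ
  have hA := ((drel_mem (X := x) hN m2 m1).iff ((drel_mem hN m2 m0).and hB)).all
  refine ⟨succ m, _, _, hm.succ, hA, hs, fun i hi => ?_, fun y hy => ?_⟩
  · rcases mem_succ.1 hi with hi | rfl
    · rw [hu.1.app_ext_of_mem hi]
      obtain ⟨δ, hδ, hδ'⟩ := huQ i hi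
      exact ⟨δ, hx.1.1 _ hγ _ hδ, hδ'⟩
    · rw [hu.1.app_ext_self]
      exact ⟨γ, hγ, hz⟩
  have f0 : ∀ w i, i ∊ succ m → app (ext (ext (ext u m z) (succ m) y) (succ (succ m)) w) i =
      app (ext u m z) i := fun w i hi => by
    rw [(hs.1.snoc y).app_ext_of_mem (mem_succ.2 (.inl hi)), hs.1.app_ext_of_mem hi]
  have f1 : ∀ w, app (ext (ext (ext u m z) (succ m) y) (succ (succ m)) w) (succ m) = y :=
    fun w => by rw [(hs.1.snoc y).app_ext_of_mem (by simp), hs.1.app_ext_self]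
  have f2 : ∀ w, app (ext (ext (ext u m z) (succ m) y) (succ (succ m)) w) (succ (succ m)) = w :=
    fun w => (hs.1.snoc y).app_ext_self
  have fm : ∀ w, app (ext (ext (ext u m z) (succ m) y) (succ (succ m)) w) m = z := fun w => by
    rw [f0 w m (by simp), hu.1.app_ext_self]
  have hBw : ∀ w, w ∊ z → (B (ext (ext (ext u m z) (succ m) y) (succ (succ m)) w) ↔
      Sat z (succ m) φ (ext u m w)) := fun w hw => by
    have := hB' (ext (ext (ext u m z) (succ m) y) (succ (succ m)) w) (ext u m w)
      ((hs.snoc hy).snoc (hzx w hw)) (by rw [fm]; exact hzx) (by rw [fm]; exact hu.snoc hw)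
      fun i hi => by
        rcases mem_succ.1 hi with hi | rfl
        · rw [hu.1.app_ext_of_mem hi, hid.1.app_ext_of_mem hi, hid' i hi,
            f0 w i (mem_succ.2 (.inl hi)), hu.1.app_ext_of_mem hi]
        · rw [hu.1.app_ext_self, hid.1.app_ext_self, f2]
    rwa [fm] at this
  simp only [f1, f2, fm]
  constructor
  · refine fun h => ext_iff.2 fun w => ⟨fun hw => ?_, fun hw => ?_⟩
    · have h' := (h w (hx.transitive y hy w hw)).1 hw
      exact (hp w).2 ⟨h'.1, (hBw w h'.1).1 h'.2⟩
    · have h' := (hp w).1 hw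
      exact (h w (hzx w h'.1)).2 ⟨h'.1, (hBw w h'.1).2 h'.2⟩
  · rintro rfl w -
    rw [hp w]
    exact and_congr_right fun hw => (hBw w hw).symm

theorem IsL.lDefinable_of_forall {α x Y : M} (hx : IsL α x)
    (h : ∀ p, p ∊ x → ∃ γ z, γ ∊ α ∧ IsL γ z ∧ LDefinable γ z p)
    (hY : DefinableFrom x (fun _ => True) Y) : LDefinable α x Y := by
  refine hY.of_pointDefinable _ (fun p hp => ?_) fun p hp => ?_
  · obtain ⟨γ, z, hγ, hz, hp'⟩ := h p hp
    exact hp'.pointDefinable hx hγ hz hp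
  · obtain ⟨γ, z, hγ, hz, -⟩ := h p hp
    exact ⟨z, hz.mem hx hγ, γ, hγ, hz⟩

/-- Every element of `L_α` is definable over some `L_γ`, `γ < α`, from earlier levels. -/
theorem IsL.exists_lDefinable {α x p : M} (hx : IsL α x) (hp : p ∊ x) :
    ∃ γ z, γ ∊ α ∧ IsL γ z ∧ LDefinable γ z p := by
  refine mem_induction (fun α => ∀ x, IsL α x → ∀ p, p ∊ x →
    ∃ γ z, γ ∊ α ∧ IsL γ z ∧ LDefinable γ z p) ?_ α x hx p hp
  intro α ih x hx p hp
  obtain ⟨h0, h1, h2, h3⟩ := hx.recursion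
  rcases hx.1.cases with rfl | ⟨γ, -, rfl⟩ | hl
  · rw [h1 rfl] at hp
    exact absurd hp not_mem_emp
  · have hγ : γ ∊ succ γ := mem_succ.2 (.inr rfl)
    obtain ⟨z, hz⟩ := h0 γ hγ
    exact ⟨γ, z, hγ, hz, hz.lDefinable_of_forall (ih γ hγ z hz) ((h2 γ z rfl hz p).1 hp)⟩
  · obtain ⟨β, y, hβ, hy, hpy⟩ := (h3 hl p).1 hp
    obtain ⟨γ, z, hγ, h⟩ := ih β hβ y hy p hpy
    exact ⟨γ, z, hx.1.1 _ hβ _ hγ, h⟩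

theorem IsL.lDefinable {α x Y : M} (hx : IsL α x) (hY : DefinableFrom x (fun _ => True) Y) :
    LDefinable α x Y := hx.lDefinable_of_forall (fun _ => hx.exists_lDefinable) hY

/-! ### Replacement for functions with transitive range -/

set_option synthInstance.maxHeartbeats 400000 in
set_option synthInstance.maxSize 2000 in
/-- Replacement for definable partial functions on a set `C` whose range is transitive.  Each value
is represented by the element of `C` that comes first in an enumeration of `C` by natural numbers;
the Mostowski collapse of the membership relation, transferred to the representatives, sends each
representative to the value it represents. -/
theorem exists_range (C : M) (R : M → M → Prop)
    [hR : Dfb (fun w : Fin 2 → M => R (w 0) (w 1))]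
    (hfun : ∀ c v v', R c v → R c v' → v = v')
    (htrans : ∀ c v w, c ∊ C → R c v → w ∊ v → ∃ d, d ∊ C ∧ R d w) :
    ∃ W, ∀ v, v ∊ W ↔ ∃ c, c ∊ C ∧ R c v := by
  have (m : ℕ) (a b : (Fin m → M) → M) [DTm a] [DTm b] : Dfb (fun w => R (a w) (b w)) :=
    hR.subst2 a b
  obtain ⟨f, hf, hinj, hnat⟩ := ZMC.models.countability C
  have hfn : ∀ c, c ∊ C → IsNat (app f c) := fun c hc => hnat c _ (hf.pairIn_iff.2 ⟨hc, rfl⟩)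
  let Rep : M → M → Prop := fun c v =>
    c ∊ C ∧ R c v ∧ ∀ d, d ∊ C → R d v → ¬ app f d ∊ app f c
  have hRep (m : ℕ) (a b : (Fin m → M) → M) [DTm a] [DTm b] : Dfb (fun w => Rep (a w) (b w)) :=
    Dfb.subst2 (by unfold Rep; infer_instance) a b
  have rep_exists : ∀ c v, c ∊ C → R c v → ∃ d, Rep d v := by
    intro c v hc hcv
    obtain ⟨k, hk, hk'⟩ := ZMC.models.regularity
      (sep (fun k => ∃ d, d ∊ C ∧ R d v ∧ k = app f d) (omega M))
      ⟨app f c, mem_sep.2 ⟨mem_omega.2 (hfn c hc), c, hc, hcv, rfl⟩⟩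
    obtain ⟨-, d, hd, hdv, rfl⟩ := mem_sep.1 hk
    exact ⟨d, hd, hdv, fun e he hev =>
      hk' _ (mem_sep.2 ⟨mem_omega.2 (hfn e he), e, he, hev, rfl⟩)⟩
  have rep_unique : ∀ c d v, Rep c v → Rep d v → c = d := by
    intro c d v hc hd
    rcases (hfn c hc.1).isOrd.trichotomy (hfn d hd.1).isOrd with h | h | h
    · exact absurd h (hd.2.2 c hc.1 hc.2.1)
    · exact hinj c d (app f c) (hf.pairIn_iff.2 ⟨hc.1, rfl⟩) (hf.pairIn_iff.2 ⟨hd.1, h.symm⟩)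
    · exact absurd h (hc.2.2 d hd.1 hd.2.1)
  have val_unique : ∀ c v v', Rep c v → Rep c v' → v = v' := fun c v v' h h' =>
    hfun c v v' h.2.1 h'.2.1
  have rep_mem : ∀ c v w, Rep c v → w ∊ v → ∃ d, Rep d w := fun c v w hc hw => by
    obtain ⟨d, hd, hdw⟩ := htrans c v w hc.1 hc.2.1 hw
    exact rep_exists d w hd hdw
  obtain ⟨A, hA⟩ := exists_sep
    (fun p : M => ∃ c d v w : M, p = pair c d ∧ Rep c v ∧ Rep d w ∧ v ∊ w) (fc C)
  have hA' : ∀ c d, PairIn A c d ↔ ∃ v w, Rep c v ∧ Rep d w ∧ v ∊ w := by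
    intro c d
    rw [pairIn_iff, hA]
    constructor
    · rintro ⟨-, c', d', v, w, e, h⟩
      obtain ⟨rfl, rfl⟩ := pair_inj.1 e
      exact ⟨v, w, h⟩
    · rintro ⟨v, w, h⟩
      exact ⟨pair_mem_fc (mem_fc h.1.1) (mem_fc h.2.1.1), c, d, v, w, rfl, h⟩
  have hfield : ∀ c, InField A c → ∃ v, Rep c v := by
    rintro c ⟨d, h | h⟩
    · obtain ⟨v, w, h, -⟩ := (hA' _ _).1 h
      exact ⟨v, h⟩
    · obtain ⟨v, w, -, h, -⟩ := (hA' _ _).1 h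
      exact ⟨w, h⟩
  have hrel : IsRel A := fun p hp => by
    obtain ⟨-, c, d, -, -, rfl, -⟩ := (hA p).1 hp
    exact ⟨c, d, isPair_iff.2 rfl⟩
  have hwf : IsWellFounded A := by
    rintro S ⟨c, hc⟩ hS
    obtain ⟨v, hv⟩ := hfield c (hS c hc)
    refine mem_induction (fun v => ∀ c, c ∊ S → Rep c v →
      ∃ k, k ∊ S ∧ ∀ j, j ∊ S → ¬ PairIn A j k) ?_ v c hc hv
    intro v ih c hc hv
    by_contra! hn
    obtain ⟨j, hj, hjc⟩ := hn c hc
    obtain ⟨v', v'', h1, h2, h3⟩ := (hA' _ _).1 hjc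
    rw [val_unique c v'' v h2 hv] at h3
    obtain ⟨k, hk, hk'⟩ := ih v' h3 j hj h1
    obtain ⟨i, hi, hi'⟩ := hn k hk
    exact hk' i hi hi'
  have hext : IsExtensional A := by
    intro c d hc hd h
    obtain ⟨v, hv⟩ := hfield c hc
    obtain ⟨w, hw⟩ := hfield d hd
    have aux : ∀ c d v w, Rep c v → Rep d w → (∀ j, PairIn A j c → PairIn A j d) → Sub v w := by
      intro c d v w hv hw h z hz
      obtain ⟨j, hj⟩ := rep_mem c v z hv hz
      obtain ⟨z', w', h1, h2, h3⟩ := (hA' _ _).1 (h j ((hA' _ _).2 ⟨z, v, hj, hv, hz⟩))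
      rwa [val_unique j z z' hj h1, val_unique d w w' hw h2]
    have e : v = w := ext_iff.2 fun z =>
      ⟨aux c d v w hv hw (fun j => (h j).1) z, aux d c w v hw hv (fun j => (h j).2) z⟩
    exact rep_unique c d v hv (e ▸ hw)
  obtain ⟨X, F, ξ, hX, hF, hξ, hiso⟩ := ZMC.models.mostowski A hrel hwf hext
  have hξ' : ∀ c, c ∊ F → PairIn ξ c (app ξ c) := fun c hc => hξ.1.pairIn_iff.2 ⟨hc, rfl⟩
  have hξX : ∀ c, c ∊ F → app ξ c ∊ X := fun c hc => (hξ.2.2 _).2 ⟨c, hξ' c hc⟩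
  have collapse : ∀ v c, Rep c v → c ∊ F → app ξ c = v := by
    refine mem_induction (fun v => ∀ c, Rep c v → c ∊ F → app ξ c = v) ?_
    intro v ih c hc hcF
    refine ext_iff.2 fun z => ⟨fun hz => ?_, fun hz => ?_⟩
    · obtain ⟨d, hd⟩ := (hξ.2.2 z).1 (hX _ (hξX c hcF) z hz)
      obtain ⟨hdF, rfl⟩ := hξ.1.pairIn_iff.1 hd
      obtain ⟨v', v'', h1, h2, h3⟩ := (hA' _ _).1 ((hiso d c _ _ hd (hξ' c hcF)).2 hz)
      rw [val_unique c v'' v h2 hc] at h3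
      rwa [ih v' h3 d h1 hdF]
    · obtain ⟨d, hd⟩ := rep_mem c v z hc hz
      have hdc := (hA' d c).2 ⟨z, v, hd, hc, hz⟩
      have hdF : d ∊ F := (hF d).2 ⟨c, .inl hdc⟩
      rw [← ih z hz d hd hdF]
      exact (hiso d c _ _ (hξ' d hdF) (hξ' c hcF)).1 hdc
  -- an isolated representative is not in the field of `A`, but then it represents `∅`
  obtain ⟨W, hW⟩ := exists_sep (fun v => ∃ c, c ∊ C ∧ R c v) (un X (upair (emp M) (emp M)))
  refine ⟨W, fun v => (hW v).trans ⟨fun h => h.2, fun h => ⟨?_, h⟩⟩⟩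
  rcases eq_emp_or_exists_mem v with rfl | ⟨z, hz⟩
  · simp
  · obtain ⟨c, hc, hcv⟩ := h
    obtain ⟨c, hc⟩ := rep_exists c v hc hcv
    obtain ⟨d, hd⟩ := rep_mem c v z hc hz
    have hcF : c ∊ F := (hF c).2 ⟨d, .inr ((hA' d c).2 ⟨z, v, hd, hc, hz⟩)⟩
    rw [mem_un, ← collapse v c hc hcF]
    exact .inl (hξX c hcF)

/-! ### Existence of the levels -/

set_option synthInstance.maxHeartbeats 400000 in
set_option synthInstance.maxSize 2000 in
theorem IsTransitive.exists_isDef {X : M} (hX : IsTransitive X) : ∃ D, IsDef D X := by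
  have hrange : ∀ v : M, (∃ c, c ∊ codes X ∧ ∃ n φ s, c = pair n (pair φ s) ∧ IsNat n ∧
      IsForm (succ n) φ ∧ IsSeq X n s ∧ ∀ y, y ∊ v ↔ y ∊ X ∧ Sat X (succ n) φ (ext s n y)) ↔
      DefinableFrom X (fun _ => True) v := by
    intro v
    rw [definableFrom_iff]
    constructor
    · rintro ⟨_, -, n, φ, s, -, hn, hφ, hs, h⟩
      exact ⟨n, φ, s, hn, hφ, hs, fun _ _ => trivial, h⟩
    · rintro ⟨n, φ, s, hn, hφ, hs, -, h⟩
      exact ⟨_, pair_mem_fc (nat_mem_codes hn) (pair_mem_fc hφ.mem_codes (hs.mem_codes hn)),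
        n, φ, s, rfl, hn, hφ, hs, h⟩
  have key := exists_range (codes X) (fun c v : M => ∃ n φ s : M, c = pair n (pair φ s) ∧
      IsNat n ∧ IsForm (succ n) φ ∧ IsSeq X n s ∧
      ∀ y, y ∊ v ↔ y ∊ X ∧ Sat X (succ n) φ (ext s n y)) ?_ ?_
  · obtain ⟨D, hD⟩ := key
    exact ⟨D, fun v => (hD v).trans (hrange v)⟩
  · rintro c v v' ⟨n, φ, s, rfl, -, -, -, h⟩ ⟨n', φ', s', e, -, -, -, h'⟩
    simp only [pair_inj] at e
    obtain ⟨rfl, rfl, rfl⟩ := e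
    exact ext_iff.2 fun y => (h y).trans (h' y).symm
  · intro c v w hc hv hw
    have hv' := (hrange v).1 ⟨c, hc, hv⟩
    exact (hrange w).2 (definableFrom_of_mem hX (hv'.sub w hw))

theorem IsL.exists_succ {γ z : M} (hz : IsL γ z) : ∃ y, IsL (succ γ) y := by
  obtain ⟨D, hD⟩ := hz.transitive.exists_isDef
  refine ⟨D, isL_intro hz.1.succ (fun δ hδ => ?_) (fun h => absurd h succ_ne_emp) ?_ fun hl => ?_⟩
  · rcases mem_succ.1 hδ with hδ | rfl
    · obtain ⟨y, hy⟩ := hz.recursion.1 δ hδ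
      exact ⟨y, hy, hD.sub hz.transitive y (hy.mem hz hδ)⟩
    · exact ⟨z, hz, hD.self_mem⟩
  · intro γ' z' e hz'
    rw [← succ_inj e] at hz'
    rwa [← hz.unique hz']
  · exact absurd ⟨γ, isSucc_iff.2 rfl⟩ hl.2.2

set_option synthInstance.maxHeartbeats 400000 in
set_option synthInstance.maxSize 2000 in
/-- The limit step.  By the elimination of parameters the elements of the earlier levels are
named by the triples of an ordinal `γ < α`, a formula, and a finite sequence of ordinals, so they
form the range of a definable function on a set. -/
theorem IsLimitOrd.exists_isL {α : M} (hα : IsLimitOrd α) (h : ∀ γ, γ ∊ α → ∃ z, IsL γ z) :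
    ∃ y, IsL α y := by
  have hrange : ∀ v : M, (∃ c, c ∊ codes α ∧ ∃ γ n φ s z q, c = pair γ (pair n (pair φ s)) ∧
      γ ∊ α ∧ IsNat n ∧ IsForm (succ n) φ ∧ IsSeq α n s ∧ IsL γ z ∧ IsSeq z n q ∧
      (∀ i, i ∊ n → IsL (app s i) (app q i)) ∧
      ∀ y, y ∊ v ↔ y ∊ z ∧ Sat z (succ n) φ (ext q n y)) ↔
      ∃ γ z, γ ∊ α ∧ IsL γ z ∧ v ∊ z := by
    intro v
    constructor
    · rintro ⟨_, -, γ, n, φ, s, z, q, -, hγ, hn, hφ, -, hz, hq, -, hv⟩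
      obtain ⟨y, hy⟩ := h _ (hα.succ_mem hγ)
      refine ⟨_, y, hα.succ_mem hγ, hy, (hy.recursion.2.2.1 γ z rfl hz v).2 ?_⟩
      exact definableFrom_iff.2 ⟨n, φ, q, hn, hφ, hq, fun _ _ => trivial, hv⟩
    · rintro ⟨β, y, hβ, hy, hv⟩
      obtain ⟨γ, z, hγ, hz, hd⟩ := hy.exists_lDefinable hv
      obtain ⟨n, φ, q, hn, hφ, hq, hqL, hv⟩ := definableFrom_iff.1 hd
      have hγα := hα.1.1 _ hβ _ hγ
      obtain ⟨s, hs, hsq⟩ := exists_seq (fun i δ : M => IsL δ (app q i)) (X := α) (n := n)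
        (fun i hi => by
          obtain ⟨δ, hδ, hδ'⟩ := hqL i hi
          exact ⟨δ, hα.1.1 _ hγα _ hδ, hδ'⟩)
        fun i δ δ' _ h1 h2 => h1.injective h2
      exact ⟨_, pair_mem_fc (mem_fc (mem_un.2 (.inr hγα))) (pair_mem_fc (nat_mem_codes hn)
        (pair_mem_fc hφ.mem_codes (hs.mem_codes hn))), γ, n, φ, s, z, q, rfl, hγα, hn, hφ, hs, hz,
        hq, hsq, hv⟩
  have key := exists_range (codes α) (fun c v : M => ∃ γ n φ s z q : M,
      c = pair γ (pair n (pair φ s)) ∧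
      γ ∊ α ∧ IsNat n ∧ IsForm (succ n) φ ∧ IsSeq α n s ∧ IsL γ z ∧ IsSeq z n q ∧
      (∀ i, i ∊ n → IsL (app s i) (app q i)) ∧
      ∀ y, y ∊ v ↔ y ∊ z ∧ Sat z (succ n) φ (ext q n y)) ?_ ?_
  · obtain ⟨W, hW⟩ := key
    have hW' := fun v => (hW v).trans (hrange v)
    refine ⟨W, isL_intro hα.1 (fun γ hγ => ?_) ?_ ?_ fun _ => hW'⟩
    · obtain ⟨z, hz⟩ := h γ hγ
      obtain ⟨y, hy⟩ := h _ (hα.succ_mem hγ)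
      exact ⟨z, hz, (hW' z).2 ⟨_, y, hα.succ_mem hγ, hy, hz.mem hy (mem_succ.2 (.inr rfl))⟩⟩
    · exact fun e => absurd (isEmptySet_iff.2 e) hα.2.1
    · exact fun γ z e _ => absurd ⟨γ, isSucc_iff.2 e⟩ hα.2.2
  · rintro c v v' ⟨γ, n, φ, s, z, q, rfl, -, -, -, -, hz, hq, hsq, hv⟩
      ⟨γ', n', φ', s', z', q', e, -, -, -, -, hz', hq', hsq', hv'⟩
    simp only [pair_inj] at e
    obtain ⟨rfl, rfl, rfl, rfl⟩ := e
    obtain rfl := hz.unique hz'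
    obtain rfl := hq.1.eq_of_app hq'.1 fun i hi => (hsq i hi).unique (hsq' i hi)
    exact ext_iff.2 fun y => (hv y).trans (hv' y).symm
  · intro c v w hc hv hw
    obtain ⟨γ, z, hγ, hz, hvz⟩ := (hrange v).1 ⟨c, hc, hv⟩
    exact (hrange w).2 ⟨γ, z, hγ, hz, hz.transitive v hvz w hw⟩

theorem IsOrd.exists_isL {α : M} (hα : IsOrd α) : ∃ x, IsL α x := by
  refine mem_induction (fun α => IsOrd α → ∃ x, IsL α x) ?_ α hα
  intro α ih hα
  have h : ∀ γ, γ ∊ α → ∃ z, IsL γ z := fun γ hγ => ih γ hγ (hα.mem hγ)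
  rcases hα.cases with rfl | ⟨γ, -, rfl⟩ | hl
  · exact ⟨emp M, isL_intro hα (by simp) (fun _ => rfl) (fun γ _ e => absurd e.symm succ_ne_emp)
      fun hl => absurd (isEmptySet_iff.2 rfl) hl.2.1⟩
  · obtain ⟨z, hz⟩ := h γ (mem_succ.2 (.inr rfl))
    exact hz.exists_succ
  · exact hl.exists_isL h

end PowerlessSet

theorem mainTheorem8 {M : Type*} [setLang.Structure M] (hM : PowerlessSet.ModelsZMC M) :
    -- each `L_α` is transitive
    (∀ α x : M, PowerlessSet.IsL α x → PowerlessSet.IsTransitive x) ∧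
    -- if `α < β` then `L_α ∈ L_β` and `L_α ⊆ L_β`
    (∀ α β x y : M, PowerlessSet.IsL α x → PowerlessSet.IsL β y → α ∊ β →
      x ∊ y ∧ PowerlessSet.Sub x y) ∧
    -- `α ⊆ L_α`
    (∀ α x : M, PowerlessSet.IsL α x → PowerlessSet.Sub α x) ∧
    -- each `Y ∈ L_{α+1}` is definable over `L_α` from parameters of the form `L_γ`, `γ < α`
    (∀ α α' x x' Y : M, PowerlessSet.IsSucc α' α → PowerlessSet.IsL α x →
      PowerlessSet.IsL α' x' → Y ∊ x' →
      PowerlessSet.DefinableFrom x (fun p => ∃ γ, γ ∊ α ∧ PowerlessSet.IsL γ p) Y) ∧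
    -- each `L_α` exists as a (unique) set, and every ordinal is constructible
    (∀ α : M, PowerlessSet.IsOrd α → ∃! x, PowerlessSet.IsL α x) ∧
    (∀ α : M, PowerlessSet.IsOrd α → PowerlessSet.IsConstructible α) := by
  have : PowerlessSet.ZMC M := ⟨hM⟩
  refine ⟨fun α x h => h.transitive, fun α β x y hx hy h => ⟨hx.mem hy h, hx.sub hy h⟩,
    fun α x h β hβ => ((h.ordinals β).2 hβ).1, ?_, ?_, ?_⟩
  · intro α α' x x' Y hα' hx hx' hY
    exact hx.lDefinable ((hx'.recursion.2.2.1 α x (PowerlessSet.isSucc_iff.1 hα') hx Y).1 hY)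
  · intro α hα
    obtain ⟨x, hx⟩ := hα.exists_isL
    exact ⟨x, hx, fun y hy => hy.unique hx⟩
  · intro α hα
    obtain ⟨x, hx⟩ := hα.succ.exists_isL
    exact ⟨_, x, hx, ((hx.ordinals α).2 (PowerlessSet.mem_succ.2 (.inr rfl))).1⟩
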